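/- Let $m>0$ and $b>0$. On $\mathbb R^2$ consider spinors $\psi:[0,\infty)\times\mathbb R^2\to\mathbb C^2$, put $$\gamma^0=\begin{pmatrix}1&0\\0&-1\end{pmatrix},\quad \alpha^1=\begin{pmatrix}0&i\\-i&0\end{pmatrix},\quad \alpha^2=\begin{pmatrix}0&1\\1&0\end{pmatrix},\qquad \mathcal D_m=-i\alpha^1\partial_1-i\alpha^2\partial_2+m\gamma^0,$$ and consider the integral equation $$\psi(t)=e^{-it\mathcal D_m}\psi_0+i\int_0^t e^{-i(t-s)\mathcal D_m}\big((b-\Delta)^{-1}|\psi(s)|^2\big)\gamma^0\psi(s)\,ds,\qquad t\ge 0. \tag{1}$$ There are functions $C,K:\mathbb R\to(0,\infty)$, depending only on $m$ and $b$, such that for every $\psi_0\in H^{1/2}(\mathbb R^2,\mathbb C^2)$ equation (1) has a unique solution $\psi\in C([0,\infty);H^{1/2}(\mathbb R^2,\mathbb C^2))$, and this solution satisfies $$\left|\langle \mathcal D_m\psi(t),\psi(t)\rangle_{L^2}\right|\le K\big(\|\psi_0\|_{H^{1/2}}\big)\,e^{C(\|\psi_0\|_{H^{1/2}})\,t}\qquad\text{for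 all } t\ge 0,$$ where $\langle\mathcal D_m u,u\rangle_{L^2}$ denotes the quadratic form of $\mathcal D_m$ on its form domain $H^{1/2}$. -/

import Mathlib

open MeasureTheory Filter Topology
open scoped FourierTransform ENNReal

noncomputable section

namespace DiracHartree

/-- The physical (and frequency) plane `ℝ²` with its Euclidean norm. -/
abbrev Plane : Type := EuclideanSpace ℝ (Fin 2)

/-- The space of spinors `ℂ²` with its Hermitian inner product. -/
abbrev Spinor : Type := EuclideanSpace ℂ (Fin 2)

/-- The Hilbert space `L²(ℝ², ℂ²)`. -/
abbrev L2 : Type := Lp (α := Plane) Spinor 2 volume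

/-- The Dirac matrix `γ⁰`. -/
def gamma0 : Matrix (Fin 2) (Fin 2) ℂ := !![1, 0; 0, -1]

/-- The matrix `α¹ = γ⁰ γ¹`. -/
def alpha1 : Matrix (Fin 2) (Fin 2) ℂ := !![0, Complex.I; -Complex.I, 0]

/-- The matrix `α² = γ⁰ γ²`. -/
def alpha2 : Matrix (Fin 2) (Fin 2) ℂ := !![0, 1; 1, 0]

/-- The matrix-valued Fourier symbol of the Dirac operator `-i α¹ ∂₁ - i α² ∂₂ + m γ⁰`. Mathlib's
Fourier transform has the kernel `exp (-2πi x·ξ)`, so `-i ∂ⱼ` has the symbol `2π ξⱼ`. -/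
def diracMatrix (m : ℝ) (ξ : Plane) : Matrix (Fin 2) (Fin 2) ℂ :=
  ((2 * Real.pi * ξ 0 : ℝ) : ℂ) • alpha1 + ((2 * Real.pi * ξ 1 : ℝ) : ℂ) • alpha2
    + (m : ℂ) • gamma0

/-- The Fourier symbol of the Dirac operator, acting on spinors. -/
def diracSymbol (m : ℝ) (ξ : Plane) : Spinor →L[ℂ] Spinor :=
  Matrix.toEuclideanCLM (𝕜 := ℂ) (diracMatrix m ξ)

theorem diracSymbol_isSelfAdjoint (m : ℝ) (ξ : Plane) : IsSelfAdjoint (diracSymbol m ξ) := by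
  have h : IsSelfAdjoint (diracMatrix m ξ) := by
    rw [IsSelfAdjoint, Matrix.star_eq_conjTranspose]
    ext i j
    fin_cases i <;> fin_cases j <;>
      simp [diracMatrix, alpha1, alpha2, gamma0, Matrix.conjTranspose_apply]
  exact h.map (Matrix.toEuclideanCLM (n := Fin 2) (𝕜 := ℂ))

theorem continuous_diracSymbol (m : ℝ) : Continuous (diracSymbol m) := by
  have h : diracSymbol m = fun ξ : Plane =>
      ((2 * Real.pi * ξ 0 : ℝ) : ℂ) • Matrix.toEuclideanCLM (n := Fin 2) (𝕜 := ℂ) alpha1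
      + ((2 * Real.pi * ξ 1 : ℝ) : ℂ) • Matrix.toEuclideanCLM (n := Fin 2) (𝕜 := ℂ) alpha2
      + (m : ℂ) • Matrix.toEuclideanCLM (n := Fin 2) (𝕜 := ℂ) gamma0 := by
    funext ξ
    simp only [diracSymbol, diracMatrix, map_add, map_smul]
  rw [h]
  fun_prop

/-- The symbol `exp (-i t D(ξ))` of the free Dirac evolution, as a linear map of spinors. -/
def propagatorSymbol (m t : ℝ) (ξ : Plane) : Spinor →L[ℂ] Spinor :=
  NormedSpace.exp ((-(Complex.I * (t : ℂ))) • diracSymbol m ξ)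

theorem continuous_propagatorSymbol (m t : ℝ) : Continuous (propagatorSymbol m t) := by
  have h := continuous_diracSymbol m
  let _ : NormedAlgebra ℚ (Spinor →L[ℂ] Spinor) := NormedAlgebra.restrictScalars ℚ ℂ _
  have h2 : Continuous fun ξ : Plane => (-(Complex.I * (t : ℂ))) • diracSymbol m ξ := by
    fun_prop
  exact (NormedSpace.exp_continuous (𝔸 := Spinor →L[ℂ] Spinor)).comp h2

theorem norm_propagatorSymbol_apply (m t : ℝ) (ξ : Plane) (v : Spinor) :
    ‖propagatorSymbol m t ξ v‖ = ‖v‖ := by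
  have ht : IsSelfAdjoint (-(t : ℂ)) := by
    simp [isSelfAdjoint_iff]
  have hs : IsSelfAdjoint ((-(t : ℂ)) • diracSymbol m ξ) :=
    ht.smul (diracSymbol_isSelfAdjoint m ξ)
  have he : propagatorSymbol m t ξ
      = (selfAdjoint.expUnitary ⟨(-(t : ℂ)) • diracSymbol m ξ, selfAdjoint.mem_iff.2 hs⟩ : Spinor →L[ℂ] Spinor) := by
    rw [selfAdjoint.expUnitary_coe, propagatorSymbol]
    congr 1
    rw [smul_smul]
    congr 1
    ring
  rw [he]
  exact ContinuousLinearMap.norm_map_of_mem_unitary (Subtype.property _) v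

theorem memLp_propagator (m t : ℝ) (u : L2) :
    MemLp (fun ξ : Plane => propagatorSymbol m t ξ (u ξ)) 2 volume := by
  refine (Lp.memLp u).of_le ?_ (Eventually.of_forall fun ξ => ?_)
  · exact (ContinuousLinearMap.apply ℂ Spinor).flip.aestronglyMeasurable_comp₂
      (continuous_propagatorSymbol m t).aestronglyMeasurable (Lp.aestronglyMeasurable u)
  · exact (norm_propagatorSymbol_apply m t ξ (u ξ)).le

/-- The free Dirac evolution `e^{-i t D_m}` on `L²(ℝ², ℂ²)`, a Fourier multiplier. -/
def propagator (m t : ℝ) (u : L2) : L2 :=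
  𝓕⁻ ((memLp_propagator m t (𝓕 u)).toLp
    (fun ξ : Plane => propagatorSymbol m t ξ ((𝓕 u : L2) ξ)))

/-- The `H^s(ℝ², ℂ²)` norm `‖(1 - Δ)^{s/2} u‖_{L²}` of `u ∈ L²` (for `s ≥ 0`), possibly `∞`;
it is computed on the Fourier side by the Plancherel theorem. -/
def sobolevENorm (s : ℝ) (u : L2) : ℝ≥0∞ :=
  eLpNorm (fun ξ : Plane => ((1 + (2 * Real.pi * ‖ξ‖) ^ 2) ^ (s / 2) : ℝ) • (𝓕 u : L2) ξ) 2 volume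

/-- Membership in the Sobolev space `H^s(ℝ², ℂ²)`, `s ≥ 0`. -/
def MemH (s : ℝ) (u : L2) : Prop := sobolevENorm s u < ∞

/-- The `H^s` norm of an element of `H^s(ℝ², ℂ²)`, `s ≥ 0`. -/
def sobolevNorm (s : ℝ) (u : L2) : ℝ := (sobolevENorm s u).toReal

/-- The potential `(b - Δ)⁻¹ |u|²`, obtained by dividing the Fourier transform of `|u|²` by
`b + |2πξ|²`. For `u ∈ H^{1/2}` the density `|u|²` is in `L¹ ∩ L²`, and both Fourier integrals
converge absolutely. -/
def potential (b : ℝ) (u : L2) (x : Plane) : ℂ :=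
  𝓕⁻ (fun ξ : Plane =>
    𝓕 (fun y : Plane => ((‖u y‖ ^ 2 : ℝ) : ℂ)) ξ / ((b + (2 * Real.pi * ‖ξ‖) ^ 2 : ℝ) : ℂ)) x

/-- The nonlinear term `((b - Δ)⁻¹ |u|²) γ⁰ u`, as a function on the plane. -/
def nonlinearity (b : ℝ) (u : L2) (x : Plane) : Spinor :=
  potential b u x • Matrix.toEuclideanCLM (𝕜 := ℂ) gamma0 (u x)

/-- `ψ ∈ C([0, ∞); H^s(ℝ², ℂ²))`. Only the values at times `t ≥ 0` matter. -/
def ContinuousInH (s : ℝ) (ψ : ℝ → L2) : Prop :=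
  (∀ t, 0 ≤ t → MemH s (ψ t)) ∧
  ∀ t, 0 ≤ t → Tendsto (fun τ => sobolevENorm s (ψ τ - ψ t)) (𝓝[Set.Ici 0] t) (𝓝 0)

/-- `ψ` solves, for all times `t ≥ 0`, the integral equation
`ψ(t) = e^{-i t D_m} ψ₀ + i ∫₀ᵗ e^{-i (t-s) D_m} ((b - Δ)⁻¹ |ψ(s)|²) γ⁰ ψ(s) ds`.
Here `F s` is the nonlinear term at time `s` as an element of `L²`, and the integral is a
(convergent) Bochner integral in `L²`. -/
def SolvesIntegralEquation (m b : ℝ) (ψ₀ : L2) (ψ : ℝ → L2) : Prop :=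
  ∃ F : ℝ → L2,
    (∀ s, 0 ≤ s → (F s : Plane → Spinor) =ᵐ[volume] nonlinearity b (ψ s)) ∧
    ∀ t, 0 ≤ t →
      IntervalIntegrable (fun s => propagator m (t - s) (F s)) volume 0 t ∧
      ψ t = propagator m t ψ₀ + Complex.I • ∫ s in (0 : ℝ)..t, propagator m (t - s) (F s)

/-- `ψ` is a global solution in `C([0, ∞); H^{1/2})` with initial datum `ψ₀`. -/
def IsGlobalSolution (m b : ℝ) (ψ₀ : L2) (ψ : ℝ → L2) : Prop :=
  ContinuousInH (1 / 2) ψ ∧ SolvesIntegralEquation m b ψ₀ ψ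

/-- The kinetic energy `⟨D_m u, u⟩_{L²}` of `u ∈ H^{1/2}`: the quadratic form of the Dirac operator,
whose form domain is `H^{1/2}`, as an absolutely convergent integral on the Fourier side. -/
def kineticEnergy (m : ℝ) (u : L2) : ℂ :=
  ∫ ξ : Plane, inner ℂ (diracSymbol m ξ ((𝓕 u : L2) ξ)) ((𝓕 u : L2) ξ)

end DiracHartree

end

/-!
The argument runs on the Fourier side, in the coordinate `g`, the Fourier transform of
`(1 - Δ)^{1/4} u`: this identifies `H^{1/2}` isometrically with `L²` (`toField`,
`sobolevENorm_toField`), and the `L²` norm of `u` becomes `‖lowerOp g‖`.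

*The nonlinearity.* The potential `(b - Δ)⁻¹ |u|²` is a superposition of plane waves with the
amplitude `potentialHat b g g ζ`, and multiplication by `e^{2πi x·ζ}` is the weighted translation
`shiftOp ζ` in the coordinate `g`. Hence the nonlinear term is the Bochner integral `hartree b g`.
The weight satisfies `s(ξ + ζ) ≤ 2 s(ξ) s(ζ)`, so everything reduces to the autocorrelation of
`g / s`, which dominates the Fourier transform of `|u|²`. Its pointwise bound `correlation_sq_le`
separates the frequencies below `|ζ|` from those above. This yields the boundedness of the trilinear
form (`exists_norm_hartreeForm_le`), and so a nonlinearity that is Lipschitz on balls of `H^{1/2}`.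
That `hartree b g` represents `((b - Δ)⁻¹ |u|²) γ⁰ u` almost everywhere is Plancherel's theorem
together with Fubini's (`coeFn_toField_hartree`).

*The equation.* Since the free evolution acts isometrically on `g`, the Duhamel equation for `ψ` in
`C([0, ∞); H^{1/2})` is equivalent to an ordinary differential equation in `L²` for
`y(t) = e^{i t D} ψ(t)` with a locally Lipschitz right-hand side (`interactionField`). Uniqueness is
Gronwall's inequality.

*Growth.* The potential is real and `γ⁰` is Hermitian, so the charge `‖ψ(t)‖_{L²}` is conserved. In
the derivative of `‖ψ(t)‖²_{H^{1/2}}` only the commutator of the weight with the potential survives;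
it gains a factor `|ζ|` over the individual terms, and the derivative is at most
`∫ s(ζ)⁻² |σ(ζ)|² dζ` up to a constant, with `σ` the autocorrelation above. Bounding the frequencies
`|ζ| < R` by the charge and the others by `correlation_sq_le` gives
`R ‖ψ‖⁴_{L²} + R⁻¹ ‖ψ‖⁴_{H^{1/2}}` (`exists_abs_inner_hartree_im_le`). With
`R = ‖ψ(t)‖²_{H^{1/2}} + 1` this is linear in `‖ψ(t)‖²_{H^{1/2}} + 1`, whence exponential growth
at most (`exists_apriori_bound`). The kinetic energy is bounded by the square of the `H^{1/2}` norm.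

*Existence.* The vector field is composed with the radial retraction to a large ball, which makes it
bounded and globally Lipschitz, so that the Picard–Lindelöf theorem gives a solution on every
`[0, T]`. As the nonlinearity is homogeneous of degree three, the truncation only multiplies it by a
factor in `[0, 1]`; the a priori bound is insensitive to such a factor, and hence the truncation is
never active once the radius exceeds the bound.
-/

noncomputable section

namespace DiracHartree

open scoped NNReal InnerProductSpace

/-! ### The Sobolev weight -/

/-- The weight `s(ξ) = (1 + |2πξ|²)^{1/4}` of `H^{1/2}`, so that
`‖u‖_{H^{1/2}} = ‖sobolevWeight · 𝓕 u‖_{L²}`. -/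
def sobolevWeight (ξ : Plane) : ℝ := (1 + (2 * Real.pi * ‖ξ‖) ^ 2) ^ ((1 / 2 : ℝ) / 2)

lemma one_le_sobolevWeight (ξ : Plane) : 1 ≤ sobolevWeight ξ :=
  Real.one_le_rpow (by nlinarith [sq_nonneg (2 * Real.pi * ‖ξ‖)]) (by norm_num)

lemma sobolevWeight_pos (ξ : Plane) : 0 < sobolevWeight ξ :=
  one_pos.trans_le (one_le_sobolevWeight ξ)

lemma sobolevWeight_pow_four (ξ : Plane) :
    sobolevWeight ξ ^ 4 = 1 + (2 * Real.pi * ‖ξ‖) ^ 2 := by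
  rw [sobolevWeight, ← Real.rpow_mul_natCast (by positivity)]
  norm_num

lemma sobolevWeight_sq (ξ : Plane) :
    sobolevWeight ξ ^ 2 = √(1 + (2 * Real.pi * ‖ξ‖) ^ 2) := by
  rw [← sobolevWeight_pow_four, show sobolevWeight ξ ^ 4 = (sobolevWeight ξ ^ 2) ^ 2 by ring,
    Real.sqrt_sq (by positivity)]

lemma continuous_sobolevWeight : Continuous sobolevWeight := by
  unfold sobolevWeight
  exact Continuous.rpow_const (by fun_prop) fun _ => Or.inr (by norm_num)

lemma sobolevWeight_neg (ξ : Plane) : sobolevWeight (-ξ) = sobolevWeight ξ := by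
  simp [sobolevWeight]

lemma two_pi_mul_norm_le_sobolevWeight_sq (ξ : Plane) :
    2 * Real.pi * ‖ξ‖ ≤ sobolevWeight ξ ^ 2 := by
  rw [sobolevWeight_sq]
  exact Real.le_sqrt_of_sq_le (by linarith)

lemma norm_le_sobolevWeight_sq (ξ : Plane) : ‖ξ‖ ≤ sobolevWeight ξ ^ 2 := by
  have := two_pi_mul_norm_le_sobolevWeight_sq ξ
  nlinarith [Real.pi_gt_three, norm_nonneg ξ]

/-- `ξ ↦ (1 + |2πξ|²)^{1/2}` is Lipschitz: it is the Euclidean norm of `(1, 2πξ)`. -/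
lemma sobolevWeight_sq_le_add (ξ η : Plane) :
    sobolevWeight ξ ^ 2 ≤ sobolevWeight η ^ 2 + 2 * Real.pi * ‖ξ - η‖ := by
  have h1 : ‖ξ‖ ≤ ‖η‖ + ‖ξ - η‖ := by
    have := norm_add_le η (ξ - η)
    rwa [add_sub_cancel] at this
  have h2 := two_pi_mul_norm_le_sobolevWeight_sq η
  have h4 := sobolevWeight_pow_four η
  rw [sobolevWeight_sq ξ]
  apply Real.sqrt_le_iff.2
  refine ⟨by positivity, ?_⟩
  have hp := Real.pi_pos
  have h3 : (2 * Real.pi * ‖ξ‖) ^ 2 ≤ (2 * Real.pi * ‖η‖ + 2 * Real.pi * ‖ξ - η‖) ^ 2 := by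
    apply pow_le_pow_left₀ (by positivity)
    nlinarith
  have h5 : 0 ≤ 2 * Real.pi * ‖ξ - η‖ := by positivity
  nlinarith [mul_le_mul_of_nonneg_right h2 h5]

lemma abs_sobolevWeight_sq_sub_le (ξ η : Plane) :
    |sobolevWeight ξ ^ 2 - sobolevWeight η ^ 2| ≤ 2 * Real.pi * ‖ξ - η‖ := by
  rw [abs_sub_le_iff]
  constructor
  · linarith [sobolevWeight_sq_le_add ξ η]
  · have := sobolevWeight_sq_le_add η ξ
    rw [norm_sub_rev] at this
    linarith

lemma abs_sobolevWeight_sub_le (ξ η : Plane) :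
    |sobolevWeight ξ - sobolevWeight η| ≤ 2 * Real.pi * ‖ξ - η‖ := by
  refine le_trans ?_ (abs_sobolevWeight_sq_sub_le ξ η)
  rw [sq_sub_sq, abs_mul, abs_of_pos (add_pos (sobolevWeight_pos ξ) (sobolevWeight_pos η))]
  have h1 := one_le_sobolevWeight ξ
  have h2 := one_le_sobolevWeight η
  nlinarith [abs_nonneg (sobolevWeight ξ - sobolevWeight η)]

lemma sobolevWeight_sq_add_le (ξ η : Plane) :
    sobolevWeight (ξ + η) ^ 2 ≤ sobolevWeight ξ ^ 2 + sobolevWeight η ^ 2 := by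
  have h := sobolevWeight_sq_le_add (ξ + η) ξ
  rw [add_sub_cancel_left] at h
  linarith [two_pi_mul_norm_le_sobolevWeight_sq η]

lemma sobolevWeight_add_le (ξ η : Plane) :
    sobolevWeight (ξ + η) ≤ 2 * sobolevWeight η * sobolevWeight ξ := by
  have h := sobolevWeight_sq_add_le ξ η
  have h1 := one_le_sobolevWeight ξ
  have h2 := one_le_sobolevWeight η
  refine le_of_sq_le_sq ?_ (by positivity)
  have h3 : sobolevWeight ξ ^ 2 ≤ sobolevWeight ξ ^ 2 * sobolevWeight η ^ 2 :=
    le_mul_of_one_le_right (by positivity) (one_le_pow₀ h2)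
  have h4 : sobolevWeight η ^ 2 ≤ sobolevWeight ξ ^ 2 * sobolevWeight η ^ 2 :=
    le_mul_of_one_le_left (by positivity) (one_le_pow₀ h1)
  nlinarith

/-- Splitting of the product of two inverse weights according to which of the two frequencies
is smaller than the frequency `c` that they produce together. -/
lemma inv_mul_inv_le_of_sq_le_add {a b c : ℝ} (ha : 0 < a) (hb : 0 < b) (hc : 0 < c)
    (h : c ^ 2 ≤ a ^ 2 + b ^ 2) :
    a⁻¹ * b⁻¹ ≤ c⁻¹ ^ 2 + 2 * c⁻¹ * (if a < c then a⁻¹ else 0)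
      + 2 * c⁻¹ * (if b < c then b⁻¹ else 0) := by
  wlog hab : a ≤ b generalizing a b
  · have := this hb ha (by linarith) (le_of_not_ge hab)
    rw [mul_comm b⁻¹] at this
    linarith
  have hn : 0 ≤ 2 * c⁻¹ * (if b < c then b⁻¹ else 0) := by
    split_ifs <;> positivity
  by_cases hac : a < c
  · rw [if_pos hac]
    have h2 : b⁻¹ ≤ 2 * c⁻¹ := by
      rw [inv_le_comm₀ hb (by positivity), mul_inv, inv_inv]
      nlinarith
    have := mul_le_mul_of_nonneg_left h2 (inv_pos.2 ha).le
    have h3 : 0 ≤ c⁻¹ ^ 2 := by positivity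
    linarith
  · rw [if_neg hac]
    push Not at hac
    have h1 : a⁻¹ ≤ c⁻¹ := inv_anti₀ hc hac
    have h2 : b⁻¹ ≤ c⁻¹ := inv_anti₀ hc (hac.trans hab)
    have := mul_le_mul h1 h2 (by positivity) (by positivity)
    nlinarith

/-- The inverse weight as an extended nonnegative real. -/
def invWeight (ξ : Plane) : ℝ≥0∞ := ENNReal.ofReal (sobolevWeight ξ)⁻¹

lemma measurable_invWeight : Measurable invWeight :=
  (continuous_sobolevWeight.measurable.inv).ennreal_ofReal

lemma invWeight_pow (ξ : Plane) (n : ℕ) :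
    invWeight ξ ^ n = ENNReal.ofReal ((sobolevWeight ξ)⁻¹ ^ n) := by
  rw [invWeight, ENNReal.ofReal_pow (inv_nonneg.2 (sobolevWeight_pos ξ).le)]

lemma invWeight_le_one (ξ : Plane) : invWeight ξ ≤ 1 := by
  rw [invWeight, ENNReal.ofReal_le_one]
  exact inv_le_one_of_one_le₀ (one_le_sobolevWeight ξ)

/-! ### Radial integrals in the plane -/

lemma sq_le_two_pi_mul_sq {y : ℝ} (hy : 0 ≤ y) : y ^ 2 ≤ (2 * Real.pi * y) ^ 2 :=
  pow_le_pow_left₀ hy (by nlinarith [Real.pi_gt_three]) 2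

lemma le_sqrt_one_add_two_pi_mul_sq {y : ℝ} (hy : 0 ≤ y) : y ≤ √(1 + (2 * Real.pi * y) ^ 2) :=
  Real.le_sqrt_of_sq_le (by linarith [sq_le_two_pi_mul_sq hy])

lemma lintegral_radial_le {φ : ℝ → ℝ} {B : ℝ} (hφ : ∀ y, 0 ≤ φ y)
    (hi : IntegrableOn (fun y => y * φ y) (Set.Ioi 0))
    (hB : ∫ y in Set.Ioi (0 : ℝ), y * φ y ≤ B) :
    ∫⁻ ξ : Plane, ENNReal.ofReal (φ ‖ξ‖) ≤ ENNReal.ofReal (2 * Real.pi * B) := by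
  have hd : Module.finrank ℝ Plane = 2 := by simp
  have h1 : Integrable (fun ξ : Plane => φ ‖ξ‖) := by
    rw [integrable_fun_norm_addHaar, hd]
    simpa using hi
  rw [← ofReal_integral_eq_lintegral_ofReal h1 (Eventually.of_forall fun _ => hφ _)]
  apply ENNReal.ofReal_le_ofReal
  rw [integral_fun_norm_addHaar (volume : Measure Plane) φ, hd]
  have hv : (volume : Measure Plane).real (Metric.ball 0 1) = Real.pi := by
    rw [measureReal_def, EuclideanSpace.volume_ball_fin_two]
    simp [Real.pi_pos.le]
  rw [hv]
  simp only [Nat.add_one_sub_one, pow_one, smul_eq_mul, nsmul_eq_mul, Nat.cast_ofNat]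
  nlinarith [Real.pi_pos]

lemma lintegral_invWeight_sq_ball_le {R : ℝ} (hR : 0 ≤ R) :
    ∫⁻ ξ in {ξ : Plane | ‖ξ‖ < R}, invWeight ξ ^ 2 ≤ ENNReal.ofReal (2 * Real.pi * R) := by
  classical
  set φ : ℝ → ℝ := fun y => if y < R then (√(1 + (2 * Real.pi * y) ^ 2))⁻¹ else 0 with hφd
  have hφ : ∀ y, 0 ≤ φ y := fun y => by
    simp only [hφd]; split_ifs <;> positivity
  have hm : Measurable φ := by
    refine Measurable.ite measurableSet_Iio ?_ measurable_const
    fun_prop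
  have hbd : ∀ y ∈ Set.Ioi (0 : ℝ), ‖y * φ y‖ ≤ (Set.Ioo 0 R).indicator (fun _ => (1 : ℝ)) y := by
    intro y hy
    have hy : 0 < y := hy
    by_cases h : y < R
    · rw [Set.indicator_of_mem (show y ∈ Set.Ioo 0 R from ⟨hy, h⟩), Real.norm_eq_abs,
        abs_of_nonneg (mul_nonneg hy.le (hφ y))]
      simp only [hφd, if_pos h]
      rw [mul_inv_le_iff₀ (by positivity), one_mul]
      exact le_sqrt_one_add_two_pi_mul_sq hy.le
    · simp [hφd, if_neg h, h]
  have hi1 : IntegrableOn ((Set.Ioo 0 R).indicator (fun _ => (1 : ℝ))) (Set.Ioi 0) := 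
    ((integrable_indicator_iff measurableSet_Ioo).2 (by simp)).integrableOn
  have hi : IntegrableOn (fun y => y * φ y) (Set.Ioi 0) :=
    Integrable.mono' hi1 (measurable_id.mul hm).aestronglyMeasurable
      ((ae_restrict_iff' measurableSet_Ioi).2 (Eventually.of_forall hbd))
  have hB : ∫ y in Set.Ioi (0 : ℝ), y * φ y ≤ R := by
    calc _ ≤ ∫ y in Set.Ioi (0 : ℝ), (Set.Ioo 0 R).indicator (fun _ => (1 : ℝ)) y :=
          setIntegral_mono_on hi hi1 measurableSet_Ioi fun y hy => (le_abs_self _).trans (hbd y hy)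
      _ = R := by
          rw [setIntegral_indicator measurableSet_Ioo]
          simp [Set.inter_eq_right.2 Set.Ioo_subset_Ioi_self, hR]
  refine le_trans (le_of_eq ?_) (lintegral_radial_le hφ hi hB)
  rw [← lintegral_indicator (measurableSet_lt measurable_norm measurable_const)]
  congr 1
  ext ξ
  by_cases h : ‖ξ‖ < R
  · rw [Set.indicator_of_mem (show ξ ∈ {ξ : Plane | ‖ξ‖ < R} from h), invWeight_pow, inv_pow,
      sobolevWeight_sq]
    simp [hφd, h]
  · simp [hφd, h]

lemma lintegral_invWeight_pow_six_compl_ball_le {R : ℝ} (hR : 0 < R) :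
    ∫⁻ ξ in {ξ : Plane | ‖ξ‖ < R}ᶜ, invWeight ξ ^ 6 ≤ ENNReal.ofReal (2 * Real.pi * R⁻¹) := by
  classical
  set φ : ℝ → ℝ := fun y => if y < R then 0 else (√(1 + (2 * Real.pi * y) ^ 2))⁻¹ ^ 3 with hφd
  have hφ : ∀ y, 0 ≤ φ y := fun y => by
    simp only [hφd]; split_ifs <;> positivity
  have hm : Measurable φ := by
    refine Measurable.ite measurableSet_Iio measurable_const ?_
    fun_prop
  have hbd : ∀ y ∈ Set.Ioi (0 : ℝ),
      ‖y * φ y‖ ≤ (Set.Ici R).indicator (fun y => y ^ (-2 : ℝ)) y := by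
    intro y hy
    have hy : 0 < y := hy
    by_cases h : y < R
    · simp [hφd, if_pos h, h]
    · rw [Set.indicator_of_mem (show y ∈ Set.Ici R from not_lt.1 h), Real.norm_eq_abs,
        abs_of_nonneg (mul_nonneg hy.le (hφ y))]
      simp only [hφd, if_neg h]
      have h1 : y ≤ √(1 + (2 * Real.pi * y) ^ 2) := le_sqrt_one_add_two_pi_mul_sq hy.le
      have h2 : (√(1 + (2 * Real.pi * y) ^ 2))⁻¹ ^ 3 ≤ y⁻¹ ^ 3 :=
        pow_le_pow_left₀ (by positivity) (inv_anti₀ hy h1) 3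
      calc _ ≤ y * y⁻¹ ^ 3 := mul_le_mul_of_nonneg_left h2 hy.le
        _ = y ^ (-2 : ℝ) := by
          rw [Real.rpow_neg hy.le]
          field_simp
          norm_num
  have hi0 : IntegrableOn (fun y : ℝ => y ^ (-2 : ℝ)) (Set.Ici R) := by
    rw [integrableOn_Ici_iff_integrableOn_Ioi]
    exact integrableOn_Ioi_rpow_of_lt (by norm_num) hR
  have hi1 : IntegrableOn ((Set.Ici R).indicator (fun y : ℝ => y ^ (-2 : ℝ))) (Set.Ioi 0) :=
    ((integrable_indicator_iff measurableSet_Ici).2 hi0).integrableOn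
  have hi : IntegrableOn (fun y => y * φ y) (Set.Ioi 0) :=
    Integrable.mono' hi1 (measurable_id.mul hm).aestronglyMeasurable
      ((ae_restrict_iff' measurableSet_Ioi).2 (Eventually.of_forall hbd))
  have hB : ∫ y in Set.Ioi (0 : ℝ), y * φ y ≤ R⁻¹ := by
    calc _ ≤ ∫ y in Set.Ioi (0 : ℝ), (Set.Ici R).indicator (fun y => y ^ (-2 : ℝ)) y :=
          setIntegral_mono_on hi hi1 measurableSet_Ioi fun y hy => (le_abs_self _).trans (hbd y hy)
      _ = R⁻¹ := by
          rw [setIntegral_indicator measurableSet_Ici,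
            Set.inter_eq_right.2 (show Set.Ici R ⊆ Set.Ioi 0 from fun y hy => hR.trans_le hy),
            integral_Ici_eq_integral_Ioi,
            integral_Ioi_rpow_of_lt (by norm_num) hR]
          norm_num
          rw [Real.rpow_neg_one]
  refine le_trans (le_of_eq ?_) (lintegral_radial_le hφ hi hB)
  rw [← lintegral_indicator (measurableSet_lt measurable_norm measurable_const).compl]
  congr 1
  ext ξ
  by_cases h : ‖ξ‖ < R
  · rw [Set.indicator_of_notMem (by simpa using h)]
    simp [hφd, h]
  · rw [Set.indicator_of_mem (by simpa using h), invWeight_pow,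
      show (sobolevWeight ξ)⁻¹ ^ 6 = ((sobolevWeight ξ ^ 2)⁻¹) ^ 3 by rw [← inv_pow]; ring,
      sobolevWeight_sq]
    simp [hφd, h]

lemma lintegral_invWeight_pow_five_lt_top : ∫⁻ ξ : Plane, invWeight ξ ^ 5 < ∞ := by
  have h := integrable_rpow_neg_one_add_norm_sq (E := Plane) (μ := volume) (r := 5 / 2)
    (by simp; norm_num)
  refine lt_of_le_of_lt (lintegral_mono fun ξ => ?_) h.lintegral_lt_top
  rw [invWeight_pow]
  apply ENNReal.ofReal_le_ofReal
  rw [inv_pow, sobolevWeight, ← Real.rpow_natCast, ← Real.rpow_mul (by positivity),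
    ← Real.rpow_neg (by positivity)]
  norm_num
  apply Real.rpow_le_rpow_of_nonpos (by positivity) _ (by norm_num)
  linarith [sq_le_two_pi_mul_sq (norm_nonneg ξ)]

/-! ### Frequency interactions -/

lemma sq_lintegral_mul_le {α : Type*} [MeasurableSpace α] {μ : Measure α} {f g : α → ℝ≥0∞}
    (hf : AEMeasurable f μ) (hg : AEMeasurable g μ) :
    (∫⁻ a, f a * g a ∂μ) ^ 2 ≤ (∫⁻ a, f a ^ 2 ∂μ) * ∫⁻ a, g a ^ 2 ∂μ := by
  have h := ENNReal.lintegral_mul_le_Lp_mul_Lq μ Real.HolderConjugate.two_two hf hg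
  have h2 := pow_le_pow_left₀ (zero_le (a := ∫⁻ a, (f * g) a ∂μ)) h 2
  refine h2.trans (le_of_eq ?_)
  rw [mul_pow, ← ENNReal.rpow_mul_natCast, ← ENNReal.rpow_mul_natCast]
  norm_num

lemma add_add_sq_le (x y z : ℝ≥0∞) : (x + y + z) ^ 2 ≤ 3 * (x ^ 2 + y ^ 2 + z ^ 2) := by
  by_cases hx : x = ∞
  · simp [hx]
  by_cases hy : y = ∞
  · simp [hy]
  by_cases hz : z = ∞
  · simp [hz]
  lift x to ℝ≥0 using hx
  lift y to ℝ≥0 using hy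
  lift z to ℝ≥0 using hz
  norm_cast
  rw [← NNReal.coe_le_coe]
  push_cast
  nlinarith [sq_nonneg ((x : ℝ) - y), sq_nonneg ((y : ℝ) - z), sq_nonneg ((x : ℝ) - z)]

lemma norm_lt_of_sobolevWeight_lt {ξ η : Plane} (h : sobolevWeight ξ < sobolevWeight η) :
    ‖ξ‖ < ‖η‖ := by
  by_contra! hc
  refine absurd h (not_lt.2 ?_)
  apply Real.rpow_le_rpow (by positivity) _ (by norm_num)
  have := Real.pi_pos
  gcongr

/-- The inverse weight, restricted to a ball. -/
def lowInvWeight (R : ℝ) : Plane → ℝ≥0∞ := {ξ : Plane | ‖ξ‖ < R}.indicator invWeight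

lemma measurable_lowInvWeight (R : ℝ) : Measurable (lowInvWeight R) :=
  measurable_invWeight.indicator (measurableSet_lt measurable_norm measurable_const)

lemma lintegral_lowInvWeight_sq_le {R : ℝ} (hR : 0 ≤ R) :
    ∫⁻ ξ, lowInvWeight R ξ ^ 2 ≤ ENNReal.ofReal (2 * Real.pi * R) := by
  refine le_trans (le_of_eq ?_) (lintegral_invWeight_sq_ball_le hR)
  rw [← lintegral_indicator (measurableSet_lt measurable_norm measurable_const)]
  congr 1
  ext ξ
  by_cases h : ‖ξ‖ < R <;> simp [lowInvWeight, h]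

lemma invWeight_mul_invWeight_le (a ζ : Plane) :
    invWeight a * invWeight (a + ζ) ≤ invWeight ζ ^ 2
      + 2 * invWeight ζ * lowInvWeight ‖ζ‖ a + 2 * invWeight ζ * lowInvWeight ‖ζ‖ (a + ζ) := by
  have h : sobolevWeight ζ ^ 2 ≤ sobolevWeight a ^ 2 + sobolevWeight (a + ζ) ^ 2 := by
    have := sobolevWeight_sq_add_le (-a) (a + ζ)
    rwa [neg_add_cancel_left, sobolevWeight_neg] at this
  have hp := inv_pos.2 (sobolevWeight_pos ζ)
  have key := inv_mul_inv_le_of_sq_le_add (sobolevWeight_pos a) (sobolevWeight_pos (a + ζ))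
    (sobolevWeight_pos ζ) h
  have hlow : ∀ η : Plane, ENNReal.ofReal (if sobolevWeight η < sobolevWeight ζ
      then (sobolevWeight η)⁻¹ else 0) ≤ lowInvWeight ‖ζ‖ η := by
    intro η
    split_ifs with hc
    · rw [lowInvWeight, Set.indicator_of_mem
        (show η ∈ {ξ : Plane | ‖ξ‖ < ‖ζ‖} from norm_lt_of_sobolevWeight_lt hc), invWeight]
    · simp
  have hnn : ∀ η : Plane, 0 ≤ if sobolevWeight η < sobolevWeight ζ
      then (sobolevWeight η)⁻¹ else 0 := fun η => by
    split_ifs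
    · exact (inv_pos.2 (sobolevWeight_pos η)).le
    · exact le_rfl
  rw [invWeight, invWeight, ← ENNReal.ofReal_mul (inv_pos.2 (sobolevWeight_pos a)).le]
  refine (ENNReal.ofReal_le_ofReal key).trans ?_
  have h2 : (2 : ℝ≥0∞) = ENNReal.ofReal 2 := by norm_num
  have h3 : ∀ x : ℝ, ENNReal.ofReal (2 * (sobolevWeight ζ)⁻¹ * x)
      = 2 * invWeight ζ * ENNReal.ofReal x := fun x => by
    rw [ENNReal.ofReal_mul (by positivity), ENNReal.ofReal_mul zero_le_two, ← h2, invWeight]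
  rw [ENNReal.ofReal_add (add_nonneg (by positivity) (mul_nonneg (by positivity) (hnn _)))
      (mul_nonneg (by positivity) (hnn _)),
    ENNReal.ofReal_add (by positivity) (mul_nonneg (by positivity) (hnn _)),
    h3, h3, invWeight_pow]
  gcongr
  · exact hlow a
  · exact hlow (a + ζ)

/-- The correlation `∫ f(a) g(a + ζ) da` of `f = F / s` and `g = G / s`, where `s` is the weight of
`H^{1/2}`. It dominates the Fourier transform of a product of two `H^{1/2}` functions. -/
def correlation (F G : Plane → ℝ≥0∞) (ζ : Plane) : ℝ≥0∞ :=
  ∫⁻ a, (invWeight a * F a) * (invWeight (a + ζ) * G (a + ζ))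

/-- The correlation of the squares. -/
def sqCorrelation (F G : Plane → ℝ≥0∞) (ζ : Plane) : ℝ≥0∞ := ∫⁻ a, F a ^ 2 * G (a + ζ) ^ 2

lemma measurable_sqCorrelation {F G : Plane → ℝ≥0∞} (hF : Measurable F) (hG : Measurable G) :
    Measurable (sqCorrelation F G) :=
  Measurable.lintegral_prod_right' (f := fun p : Plane × Plane => F p.2 ^ 2 * G (p.2 + p.1) ^ 2)
    (by fun_prop)

lemma measurable_correlation {F G : Plane → ℝ≥0∞} (hF : Measurable F) (hG : Measurable G) :
    Measurable (correlation F G) := by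
  have := measurable_invWeight
  exact Measurable.lintegral_prod_right' (f := fun p : Plane × Plane =>
    (invWeight p.2 * F p.2) * (invWeight (p.2 + p.1) * G (p.2 + p.1))) (by fun_prop)

lemma lintegral_sqCorrelation {F G : Plane → ℝ≥0∞} (hF : Measurable F) (hG : Measurable G) :
    ∫⁻ ζ, sqCorrelation F G ζ = (∫⁻ a, F a ^ 2) * ∫⁻ a, G a ^ 2 := by
  unfold sqCorrelation
  rw [lintegral_lintegral_swap (by simp only [Function.uncurry_def]; fun_prop)]
  have : ∀ a, ∫⁻ ζ, F a ^ 2 * G (a + ζ) ^ 2 = F a ^ 2 * ∫⁻ ζ, G ζ ^ 2 := fun a => by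
    rw [lintegral_const_mul _ (by fun_prop), lintegral_add_left_eq_self (fun ζ => G ζ ^ 2)]
  simp_rw [this]
  rw [lintegral_mul_const _ (by fun_prop)]

lemma correlation_sq_le_mul {F G : Plane → ℝ≥0∞} (hF : Measurable F) (hG : Measurable G)
    (ζ : Plane) : correlation F G ζ ^ 2
      ≤ (∫⁻ a, (invWeight a * F a) ^ 2) * ∫⁻ a, (invWeight a * G a) ^ 2 := by
  have := measurable_invWeight
  refine (sq_lintegral_mul_le (by fun_prop) (by fun_prop)).trans (le_of_eq ?_)
  rw [lintegral_add_right_eq_self (fun a => (invWeight a * G a) ^ 2)]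

/-- The pointwise bilinear estimate. If both frequencies `a`, `a + ζ` are at least `|ζ|`, the two
weights give the factor `s(ζ)⁻²`; otherwise the larger one gives `s(ζ)⁻¹`, and the other one is
square integrable over the ball of radius `|ζ|`, with integral `O(|ζ|)`. -/
lemma correlation_sq_le {F G : Plane → ℝ≥0∞} (hF : Measurable F) (hG : Measurable G)
    (ζ : Plane) : correlation F G ζ ^ 2 ≤
      24 * (invWeight ζ ^ 4 * ((∫⁻ a, F a ^ 2) * ∫⁻ a, G a ^ 2) + sqCorrelation F G ζ) := by
  have hl := measurable_lowInvWeight ‖ζ‖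
  set T₁ := ∫⁻ a, F a * G (a + ζ) with hT₁
  set T₂ := ∫⁻ a, lowInvWeight ‖ζ‖ a * (F a * G (a + ζ)) with hT₂
  set T₃ := ∫⁻ a, lowInvWeight ‖ζ‖ (a + ζ) * (F a * G (a + ζ)) with hT₃
  have h0 : correlation F G ζ ≤
      invWeight ζ ^ 2 * T₁ + 2 * invWeight ζ * T₂ + 2 * invWeight ζ * T₃ := by
    rw [hT₁, hT₂, hT₃, ← lintegral_const_mul _ (by fun_prop), ← lintegral_const_mul _ (by fun_prop),
      ← lintegral_const_mul _ (by fun_prop), ← lintegral_add_left (by fun_prop),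
      ← lintegral_add_left (by fun_prop)]
    apply lintegral_mono
    intro a
    have := mul_le_mul_left (invWeight_mul_invWeight_le a ζ) (F a * G (a + ζ))
    calc _ = (invWeight a * invWeight (a + ζ)) * (F a * G (a + ζ)) := by ring
      _ ≤ _ := this
      _ = _ := by ring
  have h1 : T₁ ^ 2 ≤ (∫⁻ a, F a ^ 2) * ∫⁻ a, G a ^ 2 := by
    refine (sq_lintegral_mul_le (by fun_prop) (by fun_prop)).trans (le_of_eq ?_)
    rw [lintegral_add_right_eq_self (fun a => G a ^ 2)]
  have hw : (invWeight ζ) ^ 2 * ENNReal.ofReal (2 * Real.pi * ‖ζ‖) ≤ 1 := by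
    rw [invWeight_pow, ← ENNReal.ofReal_mul (by positivity), ENNReal.ofReal_le_one, inv_pow,
      inv_mul_le_iff₀ (by have := sobolevWeight_pos ζ; positivity), mul_one]
    exact two_pi_mul_norm_le_sobolevWeight_sq ζ
  have hH : ∫⁻ a, (F a * G (a + ζ)) ^ 2 = sqCorrelation F G ζ := by
    simp only [sqCorrelation, mul_pow]
  have h2 : (2 * invWeight ζ * T₂) ^ 2 ≤ 4 * sqCorrelation F G ζ := by
    have := sq_lintegral_mul_le (μ := volume) (f := lowInvWeight ‖ζ‖)
      (g := fun a => F a * G (a + ζ)) (by fun_prop) (by fun_prop)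
    rw [hH] at this
    calc (2 * invWeight ζ * T₂) ^ 2 = 4 * invWeight ζ ^ 2 * T₂ ^ 2 := by ring
      _ ≤ 4 * invWeight ζ ^ 2 * (ENNReal.ofReal (2 * Real.pi * ‖ζ‖) * sqCorrelation F G ζ) := by
          gcongr
          exact this.trans (by gcongr; exact lintegral_lowInvWeight_sq_le (norm_nonneg _))
      _ = 4 * (invWeight ζ ^ 2 * ENNReal.ofReal (2 * Real.pi * ‖ζ‖)) * sqCorrelation F G ζ := by
          ring
      _ ≤ 4 * 1 * sqCorrelation F G ζ := by gcongr
      _ = _ := by ring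
  have h3 : (2 * invWeight ζ * T₃) ^ 2 ≤ 4 * sqCorrelation F G ζ := by
    have := sq_lintegral_mul_le (μ := volume) (f := fun a => lowInvWeight ‖ζ‖ (a + ζ))
      (g := fun a => F a * G (a + ζ)) (by fun_prop) (by fun_prop)
    rw [hH, lintegral_add_right_eq_self (fun a => lowInvWeight ‖ζ‖ a ^ 2)] at this
    calc (2 * invWeight ζ * T₃) ^ 2 = 4 * invWeight ζ ^ 2 * T₃ ^ 2 := by ring
      _ ≤ 4 * invWeight ζ ^ 2 * (ENNReal.ofReal (2 * Real.pi * ‖ζ‖) * sqCorrelation F G ζ) := by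
          gcongr
          exact this.trans (by gcongr; exact lintegral_lowInvWeight_sq_le (norm_nonneg _))
      _ = 4 * (invWeight ζ ^ 2 * ENNReal.ofReal (2 * Real.pi * ‖ζ‖)) * sqCorrelation F G ζ := by
          ring
      _ ≤ 4 * 1 * sqCorrelation F G ζ := by gcongr
      _ = _ := by ring
  calc correlation F G ζ ^ 2
      ≤ (invWeight ζ ^ 2 * T₁ + 2 * invWeight ζ * T₂ + 2 * invWeight ζ * T₃) ^ 2 := by gcongr
    _ ≤ 3 * ((invWeight ζ ^ 2 * T₁) ^ 2 + (2 * invWeight ζ * T₂) ^ 2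
          + (2 * invWeight ζ * T₃) ^ 2) := add_add_sq_le _ _ _
    _ ≤ 3 * (invWeight ζ ^ 4 * ((∫⁻ a, F a ^ 2) * ∫⁻ a, G a ^ 2) + 4 * sqCorrelation F G ζ
          + 4 * sqCorrelation F G ζ) := by
        gcongr
        rw [mul_pow, ← pow_mul]
        gcongr
    _ = 3 * (invWeight ζ ^ 4 * ((∫⁻ a, F a ^ 2) * ∫⁻ a, G a ^ 2)) + 24 * sqCorrelation F G ζ := by
        ring
    _ ≤ _ := by
        rw [mul_add]
        gcongr
        norm_num

/-- The estimate behind the boundedness of the cubic nonlinearity on `H^{1/2}`. -/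
lemma exists_lintegral_invWeight_mul_correlation_le :
    ∃ C : ℝ≥0, ∀ F G : Plane → ℝ≥0∞, Measurable F → Measurable G →
      (∫⁻ ζ, invWeight ζ ^ 3 * correlation F G ζ) ^ 2
        ≤ C * ((∫⁻ a, F a ^ 2) * ∫⁻ a, G a ^ 2) := by
  set I : ℝ≥0∞ := ∫⁻ ξ : Plane, invWeight ξ ^ 5 with hI
  have hItop : I ≠ ∞ := lintegral_invWeight_pow_five_lt_top.ne
  have hm := measurable_invWeight
  refine ⟨(I * (24 * (I + 1))).toNNReal, fun F G hF hG => ?_⟩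
  rw [ENNReal.coe_toNNReal (by finiteness)]
  have hc := measurable_correlation hF hG
  -- Cauchy–Schwarz with `s⁻³ = s^{-5/2} · s^{-1/2}`: in the plane `s⁻⁵` is integrable,
  -- and the remaining `s⁻¹ σ²` is integrable by the pointwise bilinear estimate
  set f : Plane → ℝ≥0∞ := fun ζ => invWeight ζ ^ (5 / 2 : ℝ) with hf
  set g : Plane → ℝ≥0∞ := fun ζ => invWeight ζ ^ (1 / 2 : ℝ) * correlation F G ζ with hg
  have hfg : ∀ ζ, invWeight ζ ^ 3 * correlation F G ζ = f ζ * g ζ := fun ζ => by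
    simp only [hf, hg]
    rw [← mul_assoc, ← ENNReal.rpow_add_of_nonneg _ _ (by norm_num) (by norm_num),
      ← ENNReal.rpow_natCast]
    norm_num
  have hf2 : ∀ ζ, f ζ ^ 2 = invWeight ζ ^ 5 := fun ζ => by
    simp only [hf]
    rw [← ENNReal.rpow_mul_natCast, ← ENNReal.rpow_natCast]
    norm_num
  have hg2 : ∀ ζ, g ζ ^ 2 = invWeight ζ * correlation F G ζ ^ 2 := fun ζ => by
    simp only [hg]
    rw [mul_pow, ← ENNReal.rpow_mul_natCast]
    norm_num
  simp_rw [hfg]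
  refine (sq_lintegral_mul_le (by fun_prop) (by fun_prop)).trans ?_
  simp_rw [hf2, hg2]
  rw [← hI, mul_assoc]
  gcongr
  set N := (∫⁻ a, F a ^ 2) * ∫⁻ a, G a ^ 2 with hN
  calc ∫⁻ ζ, invWeight ζ * correlation F G ζ ^ 2
      ≤ ∫⁻ ζ, 24 * (invWeight ζ ^ 5 * N + sqCorrelation F G ζ) := by
        apply lintegral_mono
        intro ζ
        calc invWeight ζ * correlation F G ζ ^ 2
            ≤ invWeight ζ * (24 * (invWeight ζ ^ 4 * N + sqCorrelation F G ζ)) := by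
              gcongr; exact correlation_sq_le hF hG ζ
          _ = 24 * (invWeight ζ ^ 5 * N + invWeight ζ * sqCorrelation F G ζ) := by ring
          _ ≤ 24 * (invWeight ζ ^ 5 * N + 1 * sqCorrelation F G ζ) := by
              gcongr; exact invWeight_le_one ζ
          _ = _ := by rw [one_mul]
    _ = 24 * (I + 1) * N := by
        rw [lintegral_const_mul _ (by have := measurable_sqCorrelation hF hG; fun_prop),
          lintegral_add_left (by fun_prop), lintegral_mul_const _ (by fun_prop),
          lintegral_sqCorrelation hF hG]
        ring

/-- The estimate behind the energy inequality: on low frequencies the correlation is bounded by the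
charge, on high frequencies by the `H^{1/2}` norm. -/
lemma lintegral_invWeight_sq_mul_correlation_sq_le {F : Plane → ℝ≥0∞} (hF : Measurable F)
    {R : ℝ} (hR : 0 < R) :
    ∫⁻ ζ, invWeight ζ ^ 2 * correlation F F ζ ^ 2 ≤
      ENNReal.ofReal (2 * Real.pi * R) * (∫⁻ a, (invWeight a * F a) ^ 2) ^ 2
      + ENNReal.ofReal (24 * (2 * Real.pi + 1) * R⁻¹) * (∫⁻ a, F a ^ 2) ^ 2 := by
  have hm := measurable_invWeight
  have hH := measurable_sqCorrelation hF hF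
  have hs : MeasurableSet {ξ : Plane | ‖ξ‖ < R} := measurableSet_lt measurable_norm measurable_const
  rw [← lintegral_add_compl _ hs]
  gcongr ?_ + ?_
  · calc ∫⁻ ζ in {ξ : Plane | ‖ξ‖ < R}, invWeight ζ ^ 2 * correlation F F ζ ^ 2
        ≤ ∫⁻ ζ in {ξ : Plane | ‖ξ‖ < R},
            invWeight ζ ^ 2 * (∫⁻ a, (invWeight a * F a) ^ 2) ^ 2 := by
          exact lintegral_mono fun ζ => mul_le_mul' le_rfl
            ((correlation_sq_le_mul hF hF ζ).trans (le_of_eq (sq _).symm))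
      _ ≤ _ := by
          rw [lintegral_mul_const _ (by fun_prop)]
          gcongr
          exact lintegral_invWeight_sq_ball_le hR.le
  · set E := ∫⁻ a, F a ^ 2 with hE
    have hsmall : ∀ ζ ∈ {ξ : Plane | ‖ξ‖ < R}ᶜ, invWeight ζ ^ 2 ≤ ENNReal.ofReal R⁻¹ := by
      intro ζ hζ
      rw [invWeight_pow, inv_pow]
      apply ENNReal.ofReal_le_ofReal
      apply inv_anti₀ hR
      have : R ≤ ‖ζ‖ := by simpa using hζ
      exact this.trans (norm_le_sobolevWeight_sq ζ)
    calc ∫⁻ ζ in {ξ : Plane | ‖ξ‖ < R}ᶜ, invWeight ζ ^ 2 * correlation F F ζ ^ 2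
        ≤ ∫⁻ ζ in {ξ : Plane | ‖ξ‖ < R}ᶜ,
            24 * (invWeight ζ ^ 6 * E ^ 2 + ENNReal.ofReal R⁻¹ * sqCorrelation F F ζ) := by
          apply setLIntegral_mono (by fun_prop)
          intro ζ hζ
          calc invWeight ζ ^ 2 * correlation F F ζ ^ 2
              ≤ invWeight ζ ^ 2 * (24 * (invWeight ζ ^ 4 * (E * E) + sqCorrelation F F ζ)) := by
                gcongr; exact correlation_sq_le hF hF ζ
            _ = 24 * (invWeight ζ ^ 6 * E ^ 2 + invWeight ζ ^ 2 * sqCorrelation F F ζ) := by ring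
            _ ≤ _ := by gcongr; exact hsmall ζ hζ
      _ = 24 * ((∫⁻ ζ in {ξ : Plane | ‖ξ‖ < R}ᶜ, invWeight ζ ^ 6) * E ^ 2
            + ENNReal.ofReal R⁻¹ * ∫⁻ ζ in {ξ : Plane | ‖ξ‖ < R}ᶜ, sqCorrelation F F ζ) := by
          rw [lintegral_const_mul _ (by fun_prop), lintegral_add_left (by fun_prop),
            lintegral_mul_const _ (by fun_prop), lintegral_const_mul _ (by fun_prop)]
      _ ≤ 24 * (ENNReal.ofReal (2 * Real.pi * R⁻¹) * E ^ 2 + ENNReal.ofReal R⁻¹ * E ^ 2) := by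
          gcongr
          · exact lintegral_invWeight_pow_six_compl_ball_le hR
          · refine (setLIntegral_le_lintegral _ _).trans (le_of_eq ?_)
            rw [lintegral_sqCorrelation hF hF, sq]
      _ = _ := by
          rw [← add_mul, ← ENNReal.ofReal_add (by positivity) (by positivity), ← mul_assoc]
          congr 1
          rw [show (24 : ℝ≥0∞) = ENNReal.ofReal 24 by norm_num,
            ← ENNReal.ofReal_mul (by norm_num)]
          congr 1
          ring

/-! ### Multiplication operators, translations and modulations on `L²` -/

lemma memLp_smul (c : BoundedContinuousFunction Plane ℂ) (f : L2) :
    MemLp (fun ξ => c ξ • f ξ) 2 volume :=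
  (Lp.memLp f).of_le_mul (c := ‖c‖)
    (c.continuous.aestronglyMeasurable.smul (Lp.aestronglyMeasurable f))
    (Eventually.of_forall fun ξ => by
      rw [norm_smul]; gcongr; exact c.norm_coe_le_norm ξ)

/-- Multiplication by a bounded continuous scalar function on `L²(ℝ², ℂ²)`. -/
def mulOp (c : BoundedContinuousFunction Plane ℂ) : L2 →L[ℂ] L2 :=
  LinearMap.mkContinuous
    { toFun := fun f => (memLp_smul c f).toLp _
      map_add' := fun f g => by
        rw [← MemLp.toLp_add, MemLp.toLp_eq_toLp_iff]
        filter_upwards [Lp.coeFn_add f g] with ξ h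
        rw [h, Pi.add_apply, Pi.add_apply, smul_add]
      map_smul' := fun a f => by
        rw [RingHom.id_apply, ← MemLp.toLp_const_smul, MemLp.toLp_eq_toLp_iff]
        filter_upwards [Lp.coeFn_smul a f] with ξ h
        simp only [h, Pi.smul_apply]
        rw [smul_comm] }
    ‖c‖ (fun f => by
      refine Lp.norm_le_mul_norm_of_ae_le_mul ?_
      filter_upwards [(memLp_smul c f).coeFn_toLp] with ξ h
      simp only [LinearMap.coe_mk, AddHom.coe_mk]
      rw [h, norm_smul]
      gcongr
      exact c.norm_coe_le_norm ξ)

lemma coeFn_mulOp (c : BoundedContinuousFunction Plane ℂ) (f : L2) :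
    mulOp c f =ᵐ[volume] fun ξ => c ξ • f ξ :=
  (memLp_smul c f).coeFn_toLp

lemma norm_mulOp_le (c : BoundedContinuousFunction Plane ℂ) (f : L2) :
    ‖mulOp c f‖ ≤ ‖c‖ * ‖f‖ :=
  ContinuousLinearMap.le_of_opNorm_le _ (LinearMap.mkContinuous_norm_le _ (norm_nonneg c) _) f

lemma mulOp_sub (c d : BoundedContinuousFunction Plane ℂ) (f : L2) :
    mulOp (c - d) f = mulOp c f - mulOp d f := by
  apply Lp.ext
  filter_upwards [coeFn_mulOp (c - d) f, coeFn_mulOp c f, coeFn_mulOp d f,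
    Lp.coeFn_sub (mulOp c f) (mulOp d f)] with ξ h1 h2 h3 h4
  rw [h1, h4, Pi.sub_apply, h2, h3, BoundedContinuousFunction.sub_apply, sub_smul]

/-- Translation `f ↦ f(· - ζ)` on `L²(ℝ², ℂ²)`. -/
def translate (ζ : Plane) : L2 →ₗᵢ[ℂ] L2 :=
  Lp.compMeasurePreservingₗᵢ ℂ (fun ξ => ξ - ζ) (measurePreserving_sub_right volume ζ)

lemma coeFn_translate (ζ : Plane) (f : L2) : translate ζ f =ᵐ[volume] fun ξ => f (ξ - ζ) :=
  Lp.coeFn_compMeasurePreserving f (measurePreserving_sub_right volume ζ)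

lemma ae_comp_sub {p : Plane → Prop} (ζ : Plane) (h : ∀ᵐ ξ, p ξ) : ∀ᵐ ξ, p (ξ - ζ) :=
  (measurePreserving_sub_right volume ζ).quasiMeasurePreserving.ae h

lemma continuous_translate {f : Plane → L2} (hf : Continuous f) :
    Continuous fun ζ => translate ζ (f ζ) := by
  have hg : Continuous fun ζ : Plane => (⟨fun ξ => ξ - ζ, by fun_prop⟩ : C(Plane, Plane)) := by
    apply ContinuousMap.continuous_of_continuous_uncurry
    simp only [Function.uncurry_def, ContinuousMap.coe_mk]
    fun_prop
  exact hf.compMeasurePreservingLp hg (fun ζ => measurePreserving_sub_right volume ζ) (by simp)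

lemma translate_neg_translate (ζ : Plane) (f : L2) : translate (-ζ) (translate ζ f) = f := by
  apply Lp.ext
  filter_upwards [coeFn_translate (-ζ) (translate ζ f), ae_comp_sub (-ζ) (coeFn_translate ζ f)]
    with ξ h1 h2
  rw [h1, h2]
  simp

lemma inner_translate_left (ζ : Plane) (f g : L2) :
    ⟪translate ζ f, g⟫_ℂ = ⟪f, translate (-ζ) g⟫_ℂ := by
  rw [← (translate (-ζ)).inner_map_map, translate_neg_translate]

/-- The bounded continuous function `x ↦ e^{2πi x·ζ}`. -/
def planeWave (ζ : Plane) : BoundedContinuousFunction Plane ℂ :=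
  BoundedContinuousFunction.ofNormedAddCommGroup
    (fun x => ((Real.fourierChar ⟪x, ζ⟫_ℝ : Circle) : ℂ))
    (by have := Real.continuous_fourierChar; fun_prop) 1 (fun x => (Circle.norm_coe _).le)

lemma planeWave_apply (ζ x : Plane) :
    planeWave ζ x = ((Real.fourierChar ⟪x, ζ⟫_ℝ : Circle) : ℂ) := rfl

/-- The action of `γ⁰` on `L²(ℝ², ℂ²)`. -/
def gammaOp : L2 →L[ℂ] L2 :=
  (Matrix.toEuclideanCLM (n := Fin 2) (𝕜 := ℂ) gamma0).compLpL 2 volume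

lemma coeFn_gammaOp (f : L2) : gammaOp f =ᵐ[volume]
    fun ξ => Matrix.toEuclideanCLM (n := Fin 2) (𝕜 := ℂ) gamma0 (f ξ) :=
  ContinuousLinearMap.coeFn_compLpL _ f

lemma norm_gamma0_apply (v : Spinor) :
    ‖Matrix.toEuclideanCLM (n := Fin 2) (𝕜 := ℂ) gamma0 v‖ = ‖v‖ := by
  simp [EuclideanSpace.norm_eq, gamma0, Matrix.ofLp_toEuclideanCLM,
    Matrix.mulVec, dotProduct, Fin.sum_univ_two]

lemma inner_gamma0_left (v w : Spinor) :
    ⟪Matrix.toEuclideanCLM (n := Fin 2) (𝕜 := ℂ) gamma0 v, w⟫_ℂ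
      = ⟪v, Matrix.toEuclideanCLM (n := Fin 2) (𝕜 := ℂ) gamma0 w⟫_ℂ := by
  simp [gamma0, Matrix.ofLp_toEuclideanCLM, PiLp.inner_apply,
    Matrix.mulVec, dotProduct, Fin.sum_univ_two]

lemma norm_gammaOp (f : L2) : ‖gammaOp f‖ = ‖f‖ := by
  rw [Lp.norm_def, Lp.norm_def, eLpNorm_congr_norm_ae (g := f)]
  filter_upwards [coeFn_gammaOp f] with ξ h
  rw [h, norm_gamma0_apply]

lemma inner_gammaOp_left (f g : L2) : ⟪gammaOp f, g⟫_ℂ = ⟪f, gammaOp g⟫_ℂ := by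
  rw [L2.inner_def, L2.inner_def]
  apply integral_congr_ae
  filter_upwards [coeFn_gammaOp f, coeFn_gammaOp g] with ξ h1 h2
  rw [h1, h2, inner_gamma0_left]

lemma mulOp_gammaOp (c : BoundedContinuousFunction Plane ℂ) (f : L2) :
    mulOp c (gammaOp f) = gammaOp (mulOp c f) := by
  apply Lp.ext
  filter_upwards [coeFn_mulOp c (gammaOp f), coeFn_gammaOp f, coeFn_mulOp c f,
    coeFn_gammaOp (mulOp c f)] with ξ h1 h2 h3 h4
  rw [h1, h2, h4, h3, map_smul]

lemma translate_gammaOp (ζ : Plane) (f : L2) :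
    translate ζ (gammaOp f) = gammaOp (translate ζ f) := by
  apply Lp.ext
  filter_upwards [coeFn_translate ζ (gammaOp f), ae_comp_sub ζ (coeFn_gammaOp f),
    coeFn_translate ζ f, coeFn_gammaOp (translate ζ f)] with ξ h1 h2 h3 h4
  rw [h1, h2, h4, h3]

/-- The inverse Fourier transform on `L²`, as a linear isometry. -/
def invFourier : L2 →ₗᵢ[ℂ] L2 := (Lp.fourierTransformₗᵢ Plane Spinor).symm.toLinearIsometry

lemma invFourier_apply (f : L2) : invFourier f = 𝓕⁻ f := rfl

lemma L2_ext_on_schwartz {S T : L2 → L2} (hS : Continuous S) (hT : Continuous T)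
    (h : ∀ f : SchwartzMap Plane Spinor, S (f.toLp 2) = T (f.toLp 2)) (u : L2) : S u = T u :=
  DenseRange.induction_on (p := fun u => S u = T u)
    (SchwartzMap.denseRange_toLpCLM (E := Plane) (F := Spinor) (μ := volume) (p := 2)
      ENNReal.ofNat_ne_top) u (isClosed_eq hS hT) h

lemma invFourier_translate (ζ : Plane) (f : L2) :
    invFourier (translate ζ f) = mulOp (planeWave ζ) (invFourier f) := by
  refine L2_ext_on_schwartz (S := fun f => invFourier (translate ζ f))
    (T := fun f => mulOp (planeWave ζ) (invFourier f))
    (invFourier.continuous.comp (translate ζ).continuous)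
    ((mulOp _).continuous.comp invFourier.continuous) (fun f => ?_) f
  have h1 : translate ζ (f.toLp 2) = (f.compSubConstCLM ℂ ζ).toLp 2 := by
    apply Lp.ext
    filter_upwards [coeFn_translate ζ (f.toLp 2), ae_comp_sub ζ (f.coeFn_toLp 2 volume),
      (f.compSubConstCLM ℂ ζ).coeFn_toLp 2] with ξ h1 h2 h3
    rw [h1, h2, h3, SchwartzMap.compSubConstCLM_apply]
  simp only [h1, invFourier_apply, SchwartzMap.toLp_fourierInv_eq]
  apply Lp.ext
  filter_upwards [coeFn_mulOp (planeWave ζ) ((𝓕⁻ f).toLp 2), (𝓕⁻ f).coeFn_toLp 2,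
    (𝓕⁻ (f.compSubConstCLM ℂ ζ)).coeFn_toLp 2] with x h1 h2 h3
  rw [h1, h2, h3, SchwartzMap.fourierInv_coe, SchwartzMap.fourierInv_coe, Real.fourierInv_eq,
    Real.fourierInv_eq, planeWave_apply]
  simp only [SchwartzMap.compSubConstCLM_apply]
  rw [← integral_add_right_eq_self _ ζ, ← integral_smul]
  congr 1
  ext1 v
  rw [add_sub_cancel_right, inner_add_left, AddChar.map_add_eq_mul, real_inner_comm x ζ, mul_comm,
    mul_smul]
  rfl

lemma invFourier_gammaOp (f : L2) : invFourier (gammaOp f) = gammaOp (invFourier f) := by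
  refine L2_ext_on_schwartz (S := fun f => invFourier (gammaOp f))
    (T := fun f => gammaOp (invFourier f))
    (invFourier.continuous.comp gammaOp.continuous)
    (gammaOp.continuous.comp invFourier.continuous) (fun f => ?_) f
  set L := Matrix.toEuclideanCLM (n := Fin 2) (𝕜 := ℂ) gamma0 with hL
  have h1 : gammaOp (f.toLp 2) = (f.postcompCLM L).toLp 2 := by
    apply Lp.ext
    filter_upwards [coeFn_gammaOp (f.toLp 2), f.coeFn_toLp 2,
      (f.postcompCLM L).coeFn_toLp 2] with ξ h1 h2 h3
    rw [h1, h2, h3, SchwartzMap.postcompCLM_apply]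
  simp only [h1, invFourier_apply, SchwartzMap.toLp_fourierInv_eq]
  apply Lp.ext
  filter_upwards [coeFn_gammaOp ((𝓕⁻ f).toLp 2), (𝓕⁻ f).coeFn_toLp 2,
    (𝓕⁻ (f.postcompCLM L)).coeFn_toLp 2] with x h1 h2 h3
  rw [h1, h2, h3, SchwartzMap.fourierInv_coe, SchwartzMap.fourierInv_coe, Real.fourierInv_eq,
    Real.fourierInv_eq, ← hL, ← L.integral_comp_comm]
  · simp only [SchwartzMap.postcompCLM_apply, Circle.smul_def, map_smul]
  · have := (Real.fourierIntegral_convergent_iff (μ := volume) (f := f) (-x)).2 f.integrable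
    simpa using this

/-- The Fourier transform of the (sesquilinear) product of two `L²` functions is the correlation of
their Fourier transforms. -/
lemma fourier_inner_eq (f g : L2) (ζ : Plane) :
    𝓕 (fun y : Plane => ⟪invFourier f y, invFourier g y⟫_ℂ) ζ = ⟪f, translate (-ζ) g⟫_ℂ := by
  rw [← invFourier.inner_map_map f, invFourier_translate, L2.inner_def, Real.fourier_eq]
  apply integral_congr_ae
  filter_upwards [coeFn_mulOp (planeWave (-ζ)) (invFourier g)] with y h
  rw [h, inner_smul_right, planeWave_apply, inner_neg_right]
  rfl

/-! ### The cubic nonlinearity on `H^{1/2}` -/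

/-- The bounded multiplier `(1 + |2πξ|²)^{-1/4}`. -/
def invWeightSymbol : BoundedContinuousFunction Plane ℂ :=
  BoundedContinuousFunction.ofNormedAddCommGroup (fun ξ => (((sobolevWeight ξ)⁻¹ : ℝ) : ℂ))
    (Complex.continuous_ofReal.comp
      (continuous_sobolevWeight.inv₀ fun ξ => (sobolevWeight_pos ξ).ne')) 1 (fun ξ => by
      rw [Complex.norm_real, Real.norm_eq_abs, abs_of_pos (inv_pos.2 (sobolevWeight_pos ξ))]
      exact inv_le_one_of_one_le₀ (one_le_sobolevWeight ξ))

/-- The ratio of weights `(1 + |2π(ξ + ζ)|²)^{1/4} / (1 + |2πξ|²)^{1/4}` as a multiplier. -/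
def weightRatio (ζ : Plane) : BoundedContinuousFunction Plane ℂ :=
  BoundedContinuousFunction.ofNormedAddCommGroup
    (fun ξ => ((sobolevWeight (ξ + ζ) * (sobolevWeight ξ)⁻¹ : ℝ) : ℂ))
    (Complex.continuous_ofReal.comp ((continuous_sobolevWeight.comp (by fun_prop)).mul
      (continuous_sobolevWeight.inv₀ fun ξ => (sobolevWeight_pos ξ).ne')))
    (2 * sobolevWeight ζ) (fun ξ => by
      have h1 := sobolevWeight_pos ξ
      have h2 := sobolevWeight_pos (ξ + ζ)
      rw [Complex.norm_real, Real.norm_eq_abs, abs_of_pos (by positivity), mul_inv_le_iff₀ h1]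
      exact sobolevWeight_add_le ξ ζ)

lemma weightRatio_apply (ζ ξ : Plane) :
    weightRatio ζ ξ = ((sobolevWeight (ξ + ζ) * (sobolevWeight ξ)⁻¹ : ℝ) : ℂ) := rfl

lemma norm_weightRatio_le (ζ : Plane) : ‖weightRatio ζ‖ ≤ 2 * sobolevWeight ζ :=
  BoundedContinuousFunction.norm_ofNormedAddCommGroup_le _
    (by have := sobolevWeight_pos ζ; positivity) _

lemma continuous_weightRatio : Continuous weightRatio := by
  refine (LipschitzWith.of_dist_le_mul (K := (2 * Real.pi).toNNReal) fun ζ η => ?_).continuous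
  rw [BoundedContinuousFunction.dist_le (by positivity)]
  intro ξ
  have h1 := sobolevWeight_pos ξ
  have h3 : (sobolevWeight ξ)⁻¹ ≤ 1 := inv_le_one_of_one_le₀ (one_le_sobolevWeight ξ)
  have h2 := abs_sobolevWeight_sub_le (ξ + ζ) (ξ + η)
  rw [weightRatio_apply, weightRatio_apply, dist_eq_norm, ← Complex.ofReal_sub, Complex.norm_real,
    Real.norm_eq_abs, ← sub_mul, abs_mul, abs_of_pos (inv_pos.2 h1), dist_eq_norm,
    Real.coe_toNNReal _ (by positivity)]
  rw [add_sub_add_left_eq_sub] at h2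
  calc _ ≤ |sobolevWeight (ξ + ζ) - sobolevWeight (ξ + η)| * 1 := by gcongr
    _ ≤ _ := by rw [mul_one]; exact h2

/-- The operator `(1 - Δ)^{-1/4}` on the Fourier side. It identifies `L²` with the Fourier
transforms of `H^{1/2}` functions. -/
def lowerOp : L2 →L[ℂ] L2 := mulOp invWeightSymbol

lemma coeFn_lowerOp (f : L2) :
    lowerOp f =ᵐ[volume] fun ξ => (((sobolevWeight ξ)⁻¹ : ℝ) : ℂ) • f ξ :=
  coeFn_mulOp _ f

lemma lowerOp_gammaOp (f : L2) : lowerOp (gammaOp f) = gammaOp (lowerOp f) :=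
  mulOp_gammaOp _ f

/-- Translation conjugated by the weight: this is the effect of multiplication by `e^{2πi x·ζ}` in
the coordinates `(1 - Δ)^{1/4} u`. -/
def shiftOp (ζ : Plane) : L2 →L[ℂ] L2 :=
  (translate ζ).toContinuousLinearMap ∘L mulOp (weightRatio ζ)

lemma shiftOp_apply (ζ : Plane) (f : L2) :
    shiftOp ζ f = translate ζ (mulOp (weightRatio ζ) f) := rfl

lemma norm_shiftOp_le (ζ : Plane) (f : L2) : ‖shiftOp ζ f‖ ≤ 2 * sobolevWeight ζ * ‖f‖ := by
  rw [shiftOp_apply, LinearIsometry.norm_map]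
  exact (norm_mulOp_le _ f).trans (by gcongr; exact norm_weightRatio_le ζ)

lemma coeFn_shiftOp (ζ : Plane) (f : L2) : shiftOp ζ f =ᵐ[volume]
    fun ξ => ((sobolevWeight ξ * (sobolevWeight (ξ - ζ))⁻¹ : ℝ) : ℂ) • f (ξ - ζ) := by
  filter_upwards [coeFn_translate ζ (mulOp (weightRatio ζ) f),
    ae_comp_sub ζ (coeFn_mulOp (weightRatio ζ) f)] with ξ h1 h2
  rw [shiftOp_apply, h1, h2, weightRatio_apply, sub_add_cancel]

lemma continuous_shiftOp_apply (f : L2) : Continuous fun ζ => shiftOp ζ f := by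
  apply continuous_translate (f := fun ζ => mulOp (weightRatio ζ) f)
  rw [continuous_iff_continuousAt]
  intro ζ
  rw [ContinuousAt, tendsto_iff_norm_sub_tendsto_zero]
  have h : Tendsto (fun η => ‖weightRatio η - weightRatio ζ‖ * ‖f‖) (𝓝 ζ) (𝓝 (0 * ‖f‖)) :=
    ((tendsto_iff_norm_sub_tendsto_zero.1 (continuous_weightRatio.tendsto ζ))).mul_const _
  rw [zero_mul] at h
  refine squeeze_zero (fun _ => norm_nonneg _) (fun η => ?_) h
  rw [← mulOp_sub]
  exact norm_mulOp_le _ f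

lemma lowerOp_shiftOp (ζ : Plane) (f : L2) :
    lowerOp (shiftOp ζ f) = translate ζ (lowerOp f) := by
  apply Lp.ext
  filter_upwards [coeFn_lowerOp (shiftOp ζ f), coeFn_shiftOp ζ f, coeFn_translate ζ (lowerOp f),
    ae_comp_sub ζ (coeFn_lowerOp f)] with ξ h1 h2 h3 h4
  rw [h1, h2, h3, h4, smul_smul, ← Complex.ofReal_mul, inv_mul_cancel_left₀
    (sobolevWeight_pos ξ).ne']

lemma measurable_enorm_coe (f : L2) : Measurable fun ξ => ‖f ξ‖ₑ :=
  (Lp.stronglyMeasurable f).enorm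

lemma lintegral_enorm_sq (f : L2) : ∫⁻ ξ, ‖f ξ‖ₑ ^ 2 = ‖f‖ₑ ^ 2 := by
  rw [Lp.enorm_def, eLpNorm_eq_lintegral_rpow_enorm_toReal (by simp) (by simp),
    ← ENNReal.rpow_mul_natCast]
  norm_num

lemma enorm_coe_lowerOp (f : L2) : ∀ᵐ ξ, ‖lowerOp f ξ‖ₑ = invWeight ξ * ‖f ξ‖ₑ := by
  filter_upwards [coeFn_lowerOp f] with ξ h
  rw [h, enorm_smul, invWeight, ← ofReal_norm (((sobolevWeight ξ)⁻¹ : ℝ) : ℂ),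
    Complex.norm_real, Real.norm_eq_abs, abs_of_pos (inv_pos.2 (sobolevWeight_pos ξ))]

lemma lintegral_invWeight_mul_enorm_sq (f : L2) :
    ∫⁻ ξ, (invWeight ξ * ‖f ξ‖ₑ) ^ 2 = ‖lowerOp f‖ₑ ^ 2 := by
  rw [← lintegral_enorm_sq]
  apply lintegral_congr_ae
  filter_upwards [enorm_coe_lowerOp f] with ξ h
  rw [h]

/-- The Fourier transform of the density `⟨u, v⟩`, where `(1 - Δ)^{1/4} u` and `(1 - Δ)^{1/4} v`
have the Fourier transforms `g` and `h`. -/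
def densityHat (g h : L2) (ζ : Plane) : ℂ := ⟪lowerOp g, translate (-ζ) (lowerOp h)⟫_ℂ

lemma continuous_densityHat (g h : L2) : Continuous (densityHat g h) := by
  have h1 : Continuous fun ζ : Plane => translate ζ (lowerOp h) :=
    continuous_translate continuous_const
  exact continuous_const.inner (h1.comp continuous_neg)

lemma enorm_densityHat_le (g h : L2) (ζ : Plane) :
    ‖densityHat g h ζ‖ₑ ≤ correlation (fun ξ => ‖g ξ‖ₑ) (fun ξ => ‖h ξ‖ₑ) ζ := by
  rw [densityHat, L2.inner_def]
  refine (enorm_integral_le_lintegral_enorm _).trans (lintegral_mono_ae ?_)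
  filter_upwards [enorm_coe_lowerOp g, coeFn_translate (-ζ) (lowerOp h),
    ae_comp_sub (-ζ) (enorm_coe_lowerOp h)] with ξ h1 h2 h3
  rw [sub_neg_eq_add] at h2 h3
  rw [← h1, ← h3, h2]
  rw [← ofReal_norm, ← ofReal_norm, ← ofReal_norm, ← ENNReal.ofReal_mul (norm_nonneg _)]
  exact ENNReal.ofReal_le_ofReal (norm_inner_le_norm _ _)

lemma densityHat_neg (g h : L2) (ζ : Plane) :
    densityHat g h (-ζ) = starRingEnd ℂ (densityHat h g ζ) := by
  rw [densityHat, densityHat, inner_conj_symm, ← inner_translate_left]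

/-- The Fourier transform of the potential `(b - Δ)⁻¹ ⟨u, v⟩`. -/
def potentialHat (b : ℝ) (g h : L2) (ζ : Plane) : ℂ :=
  densityHat g h ζ / ((b + (2 * Real.pi * ‖ζ‖) ^ 2 : ℝ) : ℂ)

lemma continuous_potentialHat {b : ℝ} (hb : 0 < b) (g h : L2) :
    Continuous (potentialHat b g h) := by
  refine (continuous_densityHat g h).div (Complex.continuous_ofReal.comp (by fun_prop)) fun ζ => ?_
  rw [Complex.ofReal_ne_zero]
  positivity

lemma potentialHat_neg (b : ℝ) (g h : L2) (ζ : Plane) :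
    potentialHat b g h (-ζ) = starRingEnd ℂ (potentialHat b h g ζ) := by
  rw [potentialHat, potentialHat, densityHat_neg, norm_neg, map_div₀, Complex.conj_ofReal]

lemma enorm_potentialHat_le {b : ℝ} (hb : 0 < b) (g h : L2) (ζ : Plane) :
    ‖potentialHat b g h ζ‖ₑ ≤ ENNReal.ofReal (1 + b⁻¹) *
      (invWeight ζ ^ 4 * correlation (fun ξ => ‖g ξ‖ₑ) (fun ξ => ‖h ξ‖ₑ) ζ) := by
  have h1 : ‖(((b + (2 * Real.pi * ‖ζ‖) ^ 2 : ℝ) : ℂ))⁻¹‖ₑ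
      ≤ ENNReal.ofReal (1 + b⁻¹) * invWeight ζ ^ 4 := by
    rw [← ofReal_norm, norm_inv, Complex.norm_real, Real.norm_eq_abs,
      abs_of_pos (by positivity), invWeight_pow, ← ENNReal.ofReal_mul (by positivity)]
    apply ENNReal.ofReal_le_ofReal
    rw [inv_pow, sobolevWeight_pow_four, ← div_eq_mul_inv, inv_eq_one_div, div_le_div_iff₀
      (by positivity) (by positivity)]
    have hX := sq_nonneg (2 * Real.pi * ‖ζ‖)
    have h2 : b⁻¹ * b = 1 := inv_mul_cancel₀ hb.ne'
    nlinarith [mul_nonneg (inv_pos.2 hb).le hX]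
  rw [potentialHat, div_eq_mul_inv, enorm_mul, mul_comm, ← mul_assoc]
  gcongr
  exact enorm_densityHat_le g h ζ

lemma enorm_potentialHat_smul_shiftOp_le {b : ℝ} (hb : 0 < b) (g h w : L2) (ζ : Plane) :
    ‖potentialHat b g h ζ • shiftOp ζ w‖ₑ ≤ ENNReal.ofReal (2 * (1 + b⁻¹)) * ‖w‖ₑ *
      (invWeight ζ ^ 3 * correlation (fun ξ => ‖g ξ‖ₑ) (fun ξ => ‖h ξ‖ₑ) ζ) := by
  have h1 : ‖shiftOp ζ w‖ₑ ≤ ENNReal.ofReal (2 * sobolevWeight ζ) * ‖w‖ₑ := by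
    rw [← ofReal_norm, ← ofReal_norm,
      ← ENNReal.ofReal_mul (by have := sobolevWeight_pos ζ; positivity)]
    exact ENNReal.ofReal_le_ofReal (norm_shiftOp_le ζ w)
  have h2 : ENNReal.ofReal (2 * sobolevWeight ζ) * invWeight ζ = ENNReal.ofReal 2 := by
    rw [invWeight, ← ENNReal.ofReal_mul (by have := sobolevWeight_pos ζ; positivity), mul_assoc,
      mul_inv_cancel₀ (sobolevWeight_pos ζ).ne', mul_one]
  rw [enorm_smul, ENNReal.ofReal_mul zero_le_two, ← h2]
  refine (mul_le_mul' (enorm_potentialHat_le hb g h ζ) h1).trans (le_of_eq ?_)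
  ring

lemma exists_lintegral_potentialHat_smul_shiftOp_le {b : ℝ} (hb : 0 < b) :
    ∃ C : ℝ≥0, ∀ g h w : L2,
      ∫⁻ ζ, ‖potentialHat b g h ζ • shiftOp ζ w‖ₑ ≤ C * (‖g‖ₑ * ‖h‖ₑ * ‖w‖ₑ) := by
  obtain ⟨C, hC⟩ := exists_lintegral_invWeight_mul_correlation_le
  refine ⟨(2 * (1 + b⁻¹)).toNNReal * NNReal.sqrt C, fun g h w => ?_⟩
  have h1 := hC _ _ (measurable_enorm_coe g) (measurable_enorm_coe h)
  have hm := measurable_correlation (measurable_enorm_coe g) (measurable_enorm_coe h)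
  have hm' := measurable_invWeight
  rw [lintegral_enorm_sq, lintegral_enorm_sq] at h1
  have h2 : ∫⁻ ζ, invWeight ζ ^ 3 * correlation (fun ξ => ‖g ξ‖ₑ) (fun ξ => ‖h ξ‖ₑ) ζ
      ≤ NNReal.sqrt C * (‖g‖ₑ * ‖h‖ₑ) := by
    rw [← ENNReal.pow_le_pow_left_iff (two_ne_zero)]
    refine h1.trans (le_of_eq ?_)
    rw [mul_pow, mul_pow, ← ENNReal.coe_pow, NNReal.sq_sqrt]
  refine (lintegral_mono fun ζ => enorm_potentialHat_smul_shiftOp_le hb g h w ζ).trans ?_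
  rw [lintegral_const_mul _ (by fun_prop)]
  refine (mul_le_mul' le_rfl h2).trans (le_of_eq ?_)
  rw [ENNReal.coe_mul, ENNReal.ofReal]
  ring

lemma continuous_potentialHat_smul_shiftOp {b : ℝ} (hb : 0 < b) (g h w : L2) :
    Continuous fun ζ => potentialHat b g h ζ • shiftOp ζ w :=
  (continuous_potentialHat hb g h).smul (continuous_shiftOp_apply w)

lemma integrable_potentialHat_smul_shiftOp {b : ℝ} (hb : 0 < b) (g h w : L2) :
    Integrable fun ζ => potentialHat b g h ζ • shiftOp ζ w := by
  refine ⟨(continuous_potentialHat_smul_shiftOp hb g h w).aestronglyMeasurable, ?_⟩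
  obtain ⟨C, hC⟩ := exists_lintegral_potentialHat_smul_shiftOp_le hb
  exact (hC g h w).trans_lt (by finiteness)

/-- The trilinear operator `((b - Δ)⁻¹ ⟨u, v⟩) γ⁰ w` in the coordinates `(1 - Δ)^{1/4} u` on the
Fourier side, written as a superposition of the operators `shiftOp`. -/
def hartreeForm (b : ℝ) (g h w : L2) : L2 :=
  ∫ ζ, potentialHat b g h ζ • shiftOp ζ (gammaOp w)

lemma exists_norm_hartreeForm_le {b : ℝ} (hb : 0 < b) :
    ∃ C : ℝ≥0, ∀ g h w : L2, ‖hartreeForm b g h w‖ ≤ C * (‖g‖ * ‖h‖ * ‖w‖) := by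
  obtain ⟨C, hC⟩ := exists_lintegral_potentialHat_smul_shiftOp_le hb
  refine ⟨C, fun g h w => ?_⟩
  have h1 := (enorm_integral_le_lintegral_enorm
    (fun ζ => potentialHat b g h ζ • shiftOp ζ (gammaOp w))).trans (hC g h (gammaOp w))
  have h2 := ENNReal.toReal_mono (by finiteness) h1
  simpa [norm_gammaOp, hartreeForm] using h2

lemma potentialHat_sub_left (b : ℝ) (g g' h : L2) (ζ : Plane) :
    potentialHat b (g - g') h ζ = potentialHat b g h ζ - potentialHat b g' h ζ := by
  simp only [potentialHat, densityHat, map_sub, inner_sub_left, sub_div]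

lemma potentialHat_sub_right (b : ℝ) (g h h' : L2) (ζ : Plane) :
    potentialHat b g (h - h') ζ = potentialHat b g h ζ - potentialHat b g h' ζ := by
  simp only [potentialHat, densityHat, map_sub, inner_sub_right, sub_div]

lemma hartreeForm_sub_left {b : ℝ} (hb : 0 < b) (g g' h w : L2) :
    hartreeForm b (g - g') h w = hartreeForm b g h w - hartreeForm b g' h w := by
  simp only [hartreeForm, potentialHat_sub_left, sub_smul]
  exact integral_sub (integrable_potentialHat_smul_shiftOp hb _ _ _)
    (integrable_potentialHat_smul_shiftOp hb _ _ _)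

lemma hartreeForm_sub_middle {b : ℝ} (hb : 0 < b) (g h h' w : L2) :
    hartreeForm b g (h - h') w = hartreeForm b g h w - hartreeForm b g h' w := by
  simp only [hartreeForm, potentialHat_sub_right, sub_smul]
  exact integral_sub (integrable_potentialHat_smul_shiftOp hb _ _ _)
    (integrable_potentialHat_smul_shiftOp hb _ _ _)

lemma hartreeForm_sub_right {b : ℝ} (hb : 0 < b) (g h w w' : L2) :
    hartreeForm b g h (w - w') = hartreeForm b g h w - hartreeForm b g h w' := by
  simp only [hartreeForm, map_sub, smul_sub]
  exact integral_sub (integrable_potentialHat_smul_shiftOp hb _ _ _)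
    (integrable_potentialHat_smul_shiftOp hb _ _ _)

/-- The cubic nonlinearity in the coordinates `(1 - Δ)^{1/4} u` on the Fourier side. -/
def hartree (b : ℝ) (g : L2) : L2 := hartreeForm b g g g

lemma hartree_smul (b θ : ℝ) (g : L2) :
    hartree b ((θ : ℂ) • g) = ((θ ^ 3 : ℝ) : ℂ) • hartree b g := by
  have h : ∀ ζ, potentialHat b ((θ : ℂ) • g) ((θ : ℂ) • g) ζ
      = ((θ ^ 2 : ℝ) : ℂ) * potentialHat b g g ζ := fun ζ => by
    simp only [potentialHat, densityHat, map_smul, inner_smul_left, inner_smul_right,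
      Complex.conj_ofReal]
    push_cast
    ring
  simp only [hartree, hartreeForm, h, map_smul]
  rw [← integral_smul]
  congr 1
  ext1 ζ
  rw [smul_smul, smul_smul]
  congr 1
  push_cast
  ring

/-- The nonlinearity is bounded and Lipschitz on balls of `H^{1/2}`. -/
lemma exists_norm_hartree_sub_le {b : ℝ} (hb : 0 < b) :
    ∃ C : ℝ≥0, (∀ g : L2, ‖hartree b g‖ ≤ C * ‖g‖ ^ 3) ∧ ∀ (R : ℝ≥0) (g h : L2), ‖g‖ ≤ R →
      ‖h‖ ≤ R → ‖hartree b g - hartree b h‖ ≤ C * (3 * R ^ 2) * ‖g - h‖ := by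
  obtain ⟨C, hC⟩ := exists_norm_hartreeForm_le hb
  refine ⟨C, fun g => (hC g g g).trans (le_of_eq (by ring)), fun R g h hg hh => ?_⟩
  have h1 : hartree b g - hartree b h = hartreeForm b (g - h) g g + hartreeForm b h (g - h) g
      + hartreeForm b h h (g - h) := by
    rw [hartreeForm_sub_left hb, hartreeForm_sub_middle hb, hartreeForm_sub_right hb, hartree,
      hartree]
    abel
  rw [h1]
  calc _ ≤ C * (‖g - h‖ * ‖g‖ * ‖g‖) + C * (‖h‖ * ‖g - h‖ * ‖g‖) + C * (‖h‖ * ‖h‖ * ‖g - h‖) :=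
        norm_add₃_le.trans (add_le_add_three (hC _ _ _) (hC _ _ _) (hC _ _ _))
    _ ≤ C * (‖g - h‖ * R * R) + C * (R * ‖g - h‖ * R) + C * (R * R * ‖g - h‖) := by gcongr
    _ = _ := by ring

/-! ### Conservation of charge and the energy inequality -/

lemma correlation_neg (F : Plane → ℝ≥0∞) (ζ : Plane) :
    correlation F F (-ζ) = correlation F F ζ := by
  rw [correlation, ← lintegral_add_right_eq_self _ ζ, correlation]
  congr 1
  ext1 a
  rw [add_neg_cancel_right, mul_comm]

lemma inner_hartree (b : ℝ) (hb : 0 < b) (g : L2) :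
    ⟪g, hartree b g⟫_ℂ = ∫ ζ, potentialHat b g g ζ * ⟪g, shiftOp ζ (gammaOp g)⟫_ℂ := by
  rw [hartree, hartreeForm, ← integral_inner (integrable_potentialHat_smul_shiftOp hb _ _ _)]
  simp only [inner_smul_right]

lemma integrable_potentialHat_mul_inner_shiftOp {b : ℝ} (hb : 0 < b) (g h w v : L2) :
    Integrable fun ζ => potentialHat b g h ζ * ⟪v, shiftOp ζ w⟫_ℂ := by
  simpa only [inner_smul_right] using
    (integrable_potentialHat_smul_shiftOp hb g h w).const_inner (𝕜 := ℂ) v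

/-- The potential is real, so complex conjugation of a pairing with it reflects frequencies. -/
lemma conj_integral_potentialHat_mul (b : ℝ) (g : L2) (c : Plane → ℂ) :
    starRingEnd ℂ (∫ ζ, potentialHat b g g ζ * c ζ)
      = ∫ ζ, potentialHat b g g ζ * starRingEnd ℂ (c (-ζ)) := by
  rw [← integral_conj, ← integral_neg_eq_self]
  congr 1
  ext1 ζ
  rw [map_mul, potentialHat_neg, Complex.conj_conj]

lemma inner_lowerOp_hartree_im {b : ℝ} (hb : 0 < b) (g : L2) :
    (⟪lowerOp g, lowerOp (hartree b g)⟫_ℂ).im = 0 := by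
  have h1 : ⟪lowerOp g, lowerOp (hartree b g)⟫_ℂ
      = ∫ ζ, potentialHat b g g ζ * ⟪lowerOp g, translate ζ (gammaOp (lowerOp g))⟫_ℂ := by
    rw [hartree, hartreeForm, ← lowerOp.integral_comp_comm
      (integrable_potentialHat_smul_shiftOp hb _ _ _), ← integral_inner
      (lowerOp.integrable_comp (integrable_potentialHat_smul_shiftOp hb _ _ _))]
    simp only [map_smul, inner_smul_right, lowerOp_shiftOp, lowerOp_gammaOp]
  rw [← Complex.conj_eq_iff_im, h1, conj_integral_potentialHat_mul]
  congr 1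
  ext1 ζ
  rw [inner_conj_symm, inner_translate_left, neg_neg, inner_gammaOp_left, translate_gammaOp]

/-- The commutator of the weight with multiplication by a plane wave: only the difference
`s(ξ)² - s(ξ - ζ)² = O(|ζ|)` of the symbols survives. -/
lemma enorm_inner_shiftOp_sub_conj_le (g : L2) (ζ : Plane) :
    ‖⟪g, shiftOp ζ (gammaOp g)⟫_ℂ - starRingEnd ℂ ⟪g, shiftOp (-ζ) (gammaOp g)⟫_ℂ‖ₑ
      ≤ ENNReal.ofReal (2 * Real.pi * ‖ζ‖)
        * correlation (fun ξ => ‖g ξ‖ₑ) (fun ξ => ‖g ξ‖ₑ) ζ := by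
  set γ := Matrix.toEuclideanCLM (n := Fin 2) (𝕜 := ℂ) gamma0 with hγ
  set p : Plane → ℂ := fun ξ => ⟪g ξ, γ (g (ξ - ζ))⟫_ℂ with hp
  have hA : (fun ξ => ⟪g ξ, shiftOp ζ (gammaOp g) ξ⟫_ℂ) =ᵐ[volume]
      fun ξ => ((sobolevWeight ξ * (sobolevWeight (ξ - ζ))⁻¹ : ℝ) : ℂ) * p ξ := by
    filter_upwards [coeFn_shiftOp ζ (gammaOp g), ae_comp_sub ζ (coeFn_gammaOp g)] with ξ h1 h2
    rw [h1, h2, inner_smul_right]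
  have hB0 : (fun ξ => ⟪shiftOp (-ζ) (gammaOp g) ξ, g ξ⟫_ℂ) =ᵐ[volume] fun ξ =>
      ((sobolevWeight ξ * (sobolevWeight (ξ + ζ))⁻¹ : ℝ) : ℂ) * ⟪γ (g (ξ + ζ)), g ξ⟫_ℂ := by
    filter_upwards [coeFn_shiftOp (-ζ) (gammaOp g), ae_comp_sub (-ζ) (coeFn_gammaOp g)]
      with ξ h1 h2
    rw [h1, h2, inner_smul_left, Complex.conj_ofReal, sub_neg_eq_add]
  have hB : (fun ξ => ⟪shiftOp (-ζ) (gammaOp g) (ξ - ζ), g (ξ - ζ)⟫_ℂ) =ᵐ[volume] fun ξ =>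
      ((sobolevWeight (ξ - ζ) * (sobolevWeight ξ)⁻¹ : ℝ) : ℂ) * p ξ := by
    filter_upwards [ae_comp_sub ζ hB0] with ξ h1
    rw [h1, sub_add_cancel, inner_gamma0_left]
  have hAi := (L2.integrable_inner (𝕜 := ℂ) g (shiftOp ζ (gammaOp g))).congr hA
  have hBi := ((L2.integrable_inner (𝕜 := ℂ) (shiftOp (-ζ) (gammaOp g)) g).comp_sub_right ζ).congr
    hB
  have h1 : ⟪g, shiftOp ζ (gammaOp g)⟫_ℂ - starRingEnd ℂ ⟪g, shiftOp (-ζ) (gammaOp g)⟫_ℂ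
      = ∫ ξ, (((sobolevWeight ξ ^ 2 - sobolevWeight (ξ - ζ) ^ 2)
          * ((sobolevWeight ξ)⁻¹ * (sobolevWeight (ξ - ζ))⁻¹) : ℝ) : ℂ) * p ξ := by
    rw [inner_conj_symm, L2.inner_def, L2.inner_def,
      ← integral_sub_right_eq_self (fun ξ => ⟪shiftOp (-ζ) (gammaOp g) ξ, g ξ⟫_ℂ) ζ,
      integral_congr_ae hA, integral_congr_ae hB, ← integral_sub hAi hBi]
    congr 1
    ext1 ξ
    have h1 := (sobolevWeight_pos ξ).ne'
    have h2 := (sobolevWeight_pos (ξ - ζ)).ne'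
    rw [← sub_mul, ← Complex.ofReal_sub]
    congr 2
    field_simp
  rw [h1, ← correlation_neg, correlation, ← lintegral_const_mul _ (by
    have := measurable_enorm_coe g
    have := measurable_invWeight
    fun_prop)]
  refine (enorm_integral_le_lintegral_enorm _).trans (lintegral_mono fun ξ => ?_)
  have h3 : 0 ≤ (sobolevWeight ξ)⁻¹ * (sobolevWeight (ξ - ζ))⁻¹ := by
    have := sobolevWeight_pos ξ
    have := sobolevWeight_pos (ξ - ζ)
    positivity
  have h4 := abs_sobolevWeight_sq_sub_le ξ (ξ - ζ)
  rw [sub_sub_cancel] at h4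
  have h5 : ‖p ξ‖ ≤ ‖g ξ‖ * ‖g (ξ - ζ)‖ :=
    (norm_inner_le_norm _ _).trans (by rw [norm_gamma0_apply])
  rw [← sub_eq_add_neg, invWeight, invWeight, ← ofReal_norm, ← ofReal_norm, ← ofReal_norm,
    ← ENNReal.ofReal_mul (inv_pos.2 (sobolevWeight_pos _)).le,
    ← ENNReal.ofReal_mul (inv_pos.2 (sobolevWeight_pos _)).le,
    ← ENNReal.ofReal_mul (mul_nonneg (inv_pos.2 (sobolevWeight_pos _)).le (norm_nonneg _)),
    ← ENNReal.ofReal_mul (by positivity)]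
  apply ENNReal.ofReal_le_ofReal
  rw [norm_mul, Complex.norm_real, Real.norm_eq_abs, abs_mul, abs_of_nonneg h3]
  calc _ ≤ 2 * Real.pi * ‖ζ‖ * ((sobolevWeight ξ)⁻¹ * (sobolevWeight (ξ - ζ))⁻¹)
        * (‖g ξ‖ * ‖g (ξ - ζ)‖) := by gcongr
    _ = _ := by ring

/-- The energy inequality: the growth of the `H^{1/2}` norm is controlled by the charge
`‖u‖²_{L²}`, up to a term that is small when the frequency threshold `R` is large. -/
lemma exists_abs_inner_hartree_im_le {b : ℝ} (hb : 0 < b) :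
    ∃ C : ℝ, 0 < C ∧ ∀ (g : L2) (R : ℝ), 0 < R →
      |(⟪g, hartree b g⟫_ℂ).im| ≤ C * (R * ‖lowerOp g‖ ^ 4 + R⁻¹ * ‖g‖ ^ 4) := by
  have hp := Real.pi_pos
  refine ⟨(1 + b⁻¹) * (24 * (2 * Real.pi + 1)), by positivity, fun g R hR => ?_⟩
  set σ := correlation (fun ξ => ‖g ξ‖ₑ) (fun ξ => ‖g ξ‖ₑ) with hσ
  set c : Plane → ℂ := fun ζ => ⟪g, shiftOp ζ (gammaOp g)⟫_ℂ with hc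
  set I := ⟪g, hartree b g⟫_ℂ with hI
  have hint := integrable_potentialHat_mul_inner_shiftOp hb g g (gammaOp g) g
  have hint' : Integrable fun ζ => potentialHat b g g ζ * starRingEnd ℂ (c (-ζ)) := by
    have h := (Complex.conjCLE.toContinuousLinearMap.integrable_comp hint).comp_neg
    refine h.congr (Eventually.of_forall fun ζ => ?_)
    simp [potentialHat_neg, hc]
  -- after the reflection `ζ ↦ -ζ` in the conjugate, the integrand is the commutator
  have h1 : I - starRingEnd ℂ I
      = ∫ ζ, potentialHat b g g ζ * (c ζ - starRingEnd ℂ (c (-ζ))) := by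
    rw [hI, inner_hartree b hb, conj_integral_potentialHat_mul, ← integral_sub hint hint']
    simp only [mul_sub, hc]
  have hw : ∀ ζ : Plane, invWeight ζ ^ 2 * ENNReal.ofReal (2 * Real.pi * ‖ζ‖) ≤ 1 := fun ζ => by
    rw [invWeight_pow, ← ENNReal.ofReal_mul (by positivity), ENNReal.ofReal_le_one, inv_pow,
      inv_mul_le_iff₀ (by have := sobolevWeight_pos ζ; positivity), mul_one]
    exact two_pi_mul_norm_le_sobolevWeight_sq ζ
  have hm := measurable_correlation (measurable_enorm_coe g) (measurable_enorm_coe g)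
  have hmw := measurable_invWeight
  have h2 : ‖I - starRingEnd ℂ I‖ₑ ≤ ENNReal.ofReal (1 + b⁻¹) *
      (ENNReal.ofReal (2 * Real.pi * R) * (‖lowerOp g‖ₑ ^ 2) ^ 2
        + ENNReal.ofReal (24 * (2 * Real.pi + 1) * R⁻¹) * (‖g‖ₑ ^ 2) ^ 2) := by
    rw [h1]
    refine (enorm_integral_le_lintegral_enorm _).trans ?_
    calc ∫⁻ ζ, ‖potentialHat b g g ζ * (c ζ - starRingEnd ℂ (c (-ζ)))‖ₑ
        ≤ ∫⁻ ζ, ENNReal.ofReal (1 + b⁻¹) * (invWeight ζ ^ 2 * σ ζ ^ 2) := by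
          refine lintegral_mono fun ζ => ?_
          rw [enorm_mul]
          calc _ ≤ ENNReal.ofReal (1 + b⁻¹) * (invWeight ζ ^ 4 * σ ζ)
                * (ENNReal.ofReal (2 * Real.pi * ‖ζ‖) * σ ζ) :=
                mul_le_mul' (enorm_potentialHat_le hb g g ζ) (enorm_inner_shiftOp_sub_conj_le g ζ)
            _ = ENNReal.ofReal (1 + b⁻¹) * (invWeight ζ ^ 2
                * (invWeight ζ ^ 2 * ENNReal.ofReal (2 * Real.pi * ‖ζ‖)) * σ ζ ^ 2) := by ring
            _ ≤ ENNReal.ofReal (1 + b⁻¹) * (invWeight ζ ^ 2 * 1 * σ ζ ^ 2) := by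
                gcongr; exact hw ζ
            _ = _ := by rw [mul_one]
      _ ≤ _ := by
          rw [lintegral_const_mul _ (by fun_prop)]
          gcongr
          have := lintegral_invWeight_sq_mul_correlation_sq_le (measurable_enorm_coe g) hR
          rwa [lintegral_invWeight_mul_enorm_sq, lintegral_enorm_sq] at this
  have h3 : ‖I - starRingEnd ℂ I‖ ≤ (1 + b⁻¹) * (2 * Real.pi * R * (‖lowerOp g‖ ^ 2) ^ 2
      + 24 * (2 * Real.pi + 1) * R⁻¹ * (‖g‖ ^ 2) ^ 2) := by
    rw [← ofReal_norm, ← ofReal_norm, ← ofReal_norm, ← ENNReal.ofReal_pow (norm_nonneg _),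
      ← ENNReal.ofReal_pow (norm_nonneg _), ← ENNReal.ofReal_pow (by positivity),
      ← ENNReal.ofReal_pow (by positivity), ← ENNReal.ofReal_mul (by positivity),
      ← ENNReal.ofReal_mul (by positivity), ← ENNReal.ofReal_add (by positivity) (by positivity),
      ← ENNReal.ofReal_mul (by positivity), ENNReal.ofReal_le_ofReal_iff (by positivity)] at h2
    exact h2
  have h4 : |I.im| ≤ ‖I - starRingEnd ℂ I‖ := by
    rw [Complex.sub_conj]
    simp
    linarith [abs_nonneg I.im]
  refine (h4.trans h3).trans ?_
  rw [mul_assoc (1 + b⁻¹)]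
  gcongr
  rw [← pow_mul, ← pow_mul, mul_add]
  have : 0 ≤ R * ‖lowerOp g‖ ^ 4 := by positivity
  norm_num only
  nlinarith

/-! ### The nonlinearity in physical space -/

lemma integrable_potentialHat {b : ℝ} (hb : 0 < b) (g h : L2) :
    Integrable (potentialHat b g h) := by
  refine ⟨(continuous_potentialHat hb g h).aestronglyMeasurable, ?_⟩
  obtain ⟨C, hC⟩ := exists_lintegral_invWeight_mul_correlation_le
  have hm := measurable_correlation (measurable_enorm_coe g) (measurable_enorm_coe h)
  have hmw := measurable_invWeight
  have h1 := hC _ _ (measurable_enorm_coe g) (measurable_enorm_coe h)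
  rw [lintegral_enorm_sq, lintegral_enorm_sq] at h1
  set A := ∫⁻ ζ, invWeight ζ ^ 3 * correlation (fun ξ => ‖g ξ‖ₑ) (fun ξ => ‖h ξ‖ₑ) ζ with hA
  have hAfin : A < ∞ := by
    by_contra! hc
    rw [top_le_iff.1 hc] at h1
    exact absurd h1 (not_le.2 (lt_of_lt_of_eq (by finiteness) (by simp)))
  refine (lintegral_mono fun ζ => enorm_potentialHat_le hb g h ζ).trans_lt ?_
  rw [lintegral_const_mul _ (by fun_prop)]
  refine ENNReal.mul_lt_top ENNReal.ofReal_lt_top ((lintegral_mono fun ζ => ?_).trans_lt hAfin)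
  rw [pow_succ]
  gcongr
  exact mul_le_of_le_one_right' (invWeight_le_one ζ)

/-- The inverse Fourier transform of an integrable function, as a bounded continuous function. -/
def fourierInvBCF (f : Plane → ℂ) (hf : Integrable f) : BoundedContinuousFunction Plane ℂ :=
  BoundedContinuousFunction.ofNormedAddCommGroup (𝓕⁻ f)
    (VectorFourier.fourierIntegral_continuous Real.continuous_fourierChar
      (continuous_inner (𝕜 := ℝ) (E := Plane)).neg hf)
    (∫ x, ‖f x‖) (fun x => VectorFourier.norm_fourierIntegral_le_integral_norm _ _ _ f x)

lemma fourierInvBCF_apply {f : Plane → ℂ} (hf : Integrable f) (x : Plane) :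
    fourierInvBCF f hf x = 𝓕⁻ f x := rfl

/-- A superposition of modulations is multiplication by an inverse Fourier transform. -/
lemma integral_smul_planeWave {f : Plane → ℂ} (hf : Integrable f) (w : L2)
    (hi : Integrable fun ζ => f ζ • mulOp (planeWave ζ) w) :
    ∫ ζ, f ζ • mulOp (planeWave ζ) w = mulOp (fourierInvBCF f hf) w := by
  refine ext_inner_left ℂ fun h => ?_
  rw [← integral_inner hi, L2.inner_def]
  have h1 : ∀ ζ, ⟪h, f ζ • mulOp (planeWave ζ) w⟫_ℂ
      = f ζ • 𝓕⁻ (fun x => ⟪h x, w x⟫_ℂ) ζ := fun ζ => by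
    rw [inner_smul_right, smul_eq_mul, L2.inner_def, Real.fourierInv_eq]
    congr 1
    apply integral_congr_ae
    filter_upwards [coeFn_mulOp (planeWave ζ) w] with x hx
    rw [hx, inner_smul_right, planeWave_apply]
    rfl
  have h2 : (fun x => ⟪h x, mulOp (fourierInvBCF f hf) w x⟫_ℂ) =ᵐ[volume]
      fun x => 𝓕⁻ f x • ⟪h x, w x⟫_ℂ := by
    filter_upwards [coeFn_mulOp (fourierInvBCF f hf) w] with x hx
    rw [hx, inner_smul_right, fourierInvBCF_apply, smul_eq_mul]
  rw [integral_congr_ae h2]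
  simp_rw [h1]
  have h3 := VectorFourier.integral_fourierIntegral_smul_eq_flip (μ := volume) (ν := volume)
    (L := -innerₗ Plane) Real.continuous_fourierChar
    (continuous_inner (𝕜 := ℝ) (E := Plane)).neg hf
    (L2.integrable_inner (𝕜 := ℂ) h w)
  have h4 : (-innerₗ Plane).flip = -innerₗ Plane := by
    ext x y
    simp [real_inner_comm]
  rw [h4] at h3
  exact h3.symm

/-- The spinor field `u ∈ H^{1/2}` with `(1 - Δ)^{1/4} u = 𝓕⁻ g`. -/
def toField (g : L2) : L2 := invFourier (lowerOp g)

lemma potential_toField (b : ℝ) (g : L2) :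
    potential b (toField g) = 𝓕⁻ (potentialHat b g g) := by
  have h : (fun y : Plane => ((‖toField g y‖ ^ 2 : ℝ) : ℂ))
      = fun y => ⟪invFourier (lowerOp g) y, invFourier (lowerOp g) y⟫_ℂ := by
    ext1 y
    rw [inner_self_eq_norm_sq_to_K]
    simp [toField]
  ext1 x
  rw [potential, h]
  refine congrArg (fun F : Plane → ℂ => 𝓕⁻ F x) ?_
  ext1 ζ
  rw [fourier_inner_eq, potentialHat, densityHat]

lemma coeFn_toField_hartree {b : ℝ} (hb : 0 < b) (g : L2) :
    toField (hartree b g) =ᵐ[volume] nonlinearity b (toField g) := by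
  have hi := integrable_potentialHat_smul_shiftOp hb g g (gammaOp g)
  set J : L2 →L[ℂ] L2 := invFourier.toContinuousLinearMap ∘L lowerOp with hJ
  have hJa : ∀ ζ, J (potentialHat b g g ζ • shiftOp ζ (gammaOp g))
      = potentialHat b g g ζ • mulOp (planeWave ζ) (gammaOp (toField g)) := fun ζ => by
    rw [map_smul]
    congr 1
    change invFourier (lowerOp (shiftOp ζ (gammaOp g))) = _
    rw [lowerOp_shiftOp, invFourier_translate, lowerOp_gammaOp, invFourier_gammaOp, toField]
  have h1 : toField (hartree b g)
      = mulOp (fourierInvBCF _ (integrable_potentialHat hb g g)) (gammaOp (toField g)) := by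
    change J (∫ ζ, _) = _
    rw [← J.integral_comp_comm hi]
    have hi2 := J.integrable_comp hi
    simp only [hJa] at hi2 ⊢
    exact integral_smul_planeWave _ _ hi2
  rw [h1]
  filter_upwards [coeFn_mulOp (fourierInvBCF _ (integrable_potentialHat hb g g))
    (gammaOp (toField g)), coeFn_gammaOp (toField g)] with x h2 h3
  rw [h2, h3, nonlinearity, potential_toField, fourierInvBCF_apply]

/-! ### The free evolution on the Fourier side -/

lemma propagatorSymbol_zero (m : ℝ) (ξ : Plane) : propagatorSymbol m 0 ξ = 1 := by
  have h : (-(Complex.I * ((0 : ℝ) : ℂ))) • diracSymbol m ξ = 0 := by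
    rw [Complex.ofReal_zero, mul_zero, neg_zero]
    exact zero_smul ℂ (diracSymbol m ξ)
  rw [propagatorSymbol, h, NormedSpace.exp_zero]

lemma propagatorSymbol_add (m s t : ℝ) (ξ : Plane) :
    propagatorSymbol m (s + t) ξ = propagatorSymbol m s ξ * propagatorSymbol m t ξ := by
  let _ : NormedAlgebra ℚ (Spinor →L[ℂ] Spinor) := NormedAlgebra.restrictScalars ℚ ℂ _
  have h : (-(Complex.I * ((s + t : ℝ) : ℂ))) • diracSymbol m ξ
      = (-(Complex.I * (s : ℂ))) • diracSymbol m ξ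
        + (-(Complex.I * (t : ℂ))) • diracSymbol m ξ := by
    refine Eq.trans ?_ (add_smul _ _ (diracSymbol m ξ))
    congr 1
    push_cast
    ring
  rw [propagatorSymbol, propagatorSymbol, propagatorSymbol, h, NormedSpace.exp_add_of_commute
    (((Commute.refl _).smul_left _).smul_right _)]

lemma continuous_propagatorSymbol_time (m : ℝ) (ξ : Plane) :
    Continuous fun t => propagatorSymbol m t ξ := by
  let _ : NormedAlgebra ℚ (Spinor →L[ℂ] Spinor) := NormedAlgebra.restrictScalars ℚ ℂ _
  have h : Continuous fun t : ℝ => (-(Complex.I * (t : ℂ))) • diracSymbol m ξ := by fun_prop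
  exact (NormedSpace.exp_continuous (𝔸 := Spinor →L[ℂ] Spinor)).comp h

/-- The free Dirac evolution on the Fourier side: multiplication by `exp (-i t D(ξ))`. -/
def freeFlow (m t : ℝ) : L2 →ₗᵢ[ℂ] L2 where
  toFun f := (memLp_propagator m t f).toLp _
  map_add' f g := by
    rw [← MemLp.toLp_add, MemLp.toLp_eq_toLp_iff]
    filter_upwards [Lp.coeFn_add f g] with ξ h
    rw [h, Pi.add_apply, Pi.add_apply, map_add]
  map_smul' a f := by
    rw [RingHom.id_apply, ← MemLp.toLp_const_smul, MemLp.toLp_eq_toLp_iff]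
    filter_upwards [Lp.coeFn_smul a f] with ξ h
    rw [h, Pi.smul_apply, Pi.smul_apply, map_smul]
  norm_map' f := by
    simp only [LinearMap.coe_mk, AddHom.coe_mk]
    rw [Lp.norm_toLp, Lp.norm_def, eLpNorm_congr_norm_ae (g := f)]
    exact Eventually.of_forall fun ξ => norm_propagatorSymbol_apply m t ξ (f ξ)

lemma coeFn_freeFlow (m t : ℝ) (f : L2) :
    freeFlow m t f =ᵐ[volume] fun ξ => propagatorSymbol m t ξ (f ξ) :=
  (memLp_propagator m t f).coeFn_toLp

lemma freeFlow_add (m s t : ℝ) (f : L2) :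
    freeFlow m (s + t) f = freeFlow m s (freeFlow m t f) := by
  apply Lp.ext
  filter_upwards [coeFn_freeFlow m (s + t) f, coeFn_freeFlow m s (freeFlow m t f),
    coeFn_freeFlow m t f] with ξ h1 h2 h3
  rw [h1, h2, h3, propagatorSymbol_add]
  rfl

lemma freeFlow_zero (m : ℝ) (f : L2) : freeFlow m 0 f = f := by
  apply Lp.ext
  filter_upwards [coeFn_freeFlow m 0 f] with ξ h1
  rw [h1, propagatorSymbol_zero]
  rfl

lemma freeFlow_freeFlow_neg (m t : ℝ) (f : L2) : freeFlow m t (freeFlow m (-t) f) = f := by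
  rw [← freeFlow_add, add_neg_cancel, freeFlow_zero]

lemma inner_freeFlow_neg_right (m t : ℝ) (f g : L2) :
    ⟪f, freeFlow m (-t) g⟫_ℂ = ⟪freeFlow m t f, g⟫_ℂ := by
  rw [← (freeFlow m t).inner_map_map, freeFlow_freeFlow_neg]

lemma lowerOp_freeFlow (m t : ℝ) (f : L2) :
    lowerOp (freeFlow m t f) = freeFlow m t (lowerOp f) := by
  apply Lp.ext
  filter_upwards [coeFn_lowerOp (freeFlow m t f), coeFn_freeFlow m t f,
    coeFn_freeFlow m t (lowerOp f), coeFn_lowerOp f] with ξ h1 h2 h3 h4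
  rw [h1, h2, h3, h4, map_smul]

lemma continuous_freeFlow_time (m : ℝ) (f : L2) : Continuous fun t => freeFlow m t f := by
  have hw : ∀ h : L2, Continuous fun t => ⟪h, freeFlow m t f⟫_ℂ := by
    intro h
    have h1 : ∀ t, ⟪h, freeFlow m t f⟫_ℂ = ∫ ξ, ⟪h ξ, propagatorSymbol m t ξ (f ξ)⟫_ℂ := by
      intro t
      rw [L2.inner_def]
      apply integral_congr_ae
      filter_upwards [coeFn_freeFlow m t f] with ξ h2
      rw [h2]
    simp_rw [h1]
    refine continuous_of_dominated (bound := fun ξ => ‖h ξ‖ * ‖f ξ‖) (fun t => ?_) (fun t => ?_)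
      ?_ ?_
    · exact (Lp.aestronglyMeasurable h).inner (memLp_propagator m t f).aestronglyMeasurable
    · refine Eventually.of_forall fun ξ => (norm_inner_le_norm _ _).trans ?_
      rw [norm_propagatorSymbol_apply]
    · exact (Lp.memLp h).norm.integrable_mul (Lp.memLp f).norm
    · refine Eventually.of_forall fun ξ => continuous_const.inner ?_
      exact (continuous_propagatorSymbol_time m ξ).clm_apply continuous_const
  rw [continuous_iff_continuousAt]
  intro t₀
  -- weak continuity together with constancy of the norm gives strong continuity
  have h1 : ∀ t, ‖freeFlow m t f - freeFlow m t₀ f‖ ^ 2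
      = 2 * ‖f‖ ^ 2 - 2 * (⟪freeFlow m t₀ f, freeFlow m t f⟫_ℂ).re := by
    intro t
    rw [norm_sub_rev, @norm_sub_sq ℂ, LinearIsometry.norm_map, LinearIsometry.norm_map]
    simp only [RCLike.re_to_complex]
    ring
  have h2 : Tendsto (fun t => ‖freeFlow m t f - freeFlow m t₀ f‖ ^ 2) (𝓝 t₀) (𝓝 0) := by
    have h3 : Continuous fun t => ‖freeFlow m t f - freeFlow m t₀ f‖ ^ 2 := by
      simp_rw [h1]
      exact continuous_const.sub (continuous_const.mul (Complex.continuous_re.comp (hw _)))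
    simpa using h3.tendsto t₀
  rw [ContinuousAt, tendsto_iff_norm_sub_tendsto_zero]
  have h4 := (Real.continuous_sqrt.tendsto _).comp h2
  simpa [Function.comp_def, Real.sqrt_sq] using h4

lemma continuous_freeFlow (m : ℝ) : Continuous fun p : ℝ × L2 => freeFlow m p.1 p.2 :=
  continuous_prod_of_continuous_lipschitzWith' _ 1
    (fun t => (freeFlow m t).lipschitz) (fun f => continuous_freeFlow_time m f)

/-! ### The equation in the interaction picture -/

lemma continuous_hartree {b : ℝ} (hb : 0 < b) : Continuous (hartree b) := by
  obtain ⟨C, -, hC⟩ := exists_norm_hartree_sub_le hb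
  rw [continuous_iff_continuousAt]
  intro g
  set R : ℝ≥0 := ‖g‖₊ + 1 with hR
  have h1 : LipschitzOnWith (C * (3 * R ^ 2)) (hartree b) (Metric.closedBall 0 R) :=
    LipschitzOnWith.of_dist_le_mul fun x hx y hy => by
      rw [dist_eq_norm, dist_eq_norm]
      exact hC R x y (by simpa using hx) (by simpa using hy)
  refine h1.continuousOn.continuousAt (mem_of_superset (Metric.ball_mem_nhds g one_pos) ?_)
  intro x hx
  rw [Metric.mem_ball, dist_eq_norm] at hx
  rw [mem_closedBall_zero_iff, hR]
  push_cast
  have := norm_sub_norm_le x g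
  linarith

/-- The vector field of the equation for `e^{i t D} ψ(t)`, in the coordinates `(1 - Δ)^{1/4} u` on
the Fourier side. -/
def interactionField (m b t : ℝ) (y : L2) : L2 :=
  Complex.I • freeFlow m (-t) (hartree b (freeFlow m t y))

lemma continuous_interactionField (m : ℝ) {b : ℝ} (hb : 0 < b) :
    Continuous fun p : ℝ × L2 => interactionField m b p.1 p.2 := by
  have h1 : Continuous fun p : ℝ × L2 => hartree b (freeFlow m p.1 p.2) :=
    (continuous_hartree hb).comp (continuous_freeFlow m)
  exact ((continuous_freeFlow m).comp (continuous_fst.neg.prodMk h1)).const_smul Complex.I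

lemma exists_norm_interactionField_sub_le {b : ℝ} (hb : 0 < b) :
    ∃ C : ℝ≥0, (∀ (m t : ℝ) (y : L2), ‖interactionField m b t y‖ ≤ C * ‖y‖ ^ 3) ∧
      ∀ (m t : ℝ) (R : ℝ≥0) (y z : L2), ‖y‖ ≤ R → ‖z‖ ≤ R →
        ‖interactionField m b t y - interactionField m b t z‖ ≤ C * (3 * R ^ 2) * ‖y - z‖ := by
  obtain ⟨C, hC1, hC2⟩ := exists_norm_hartree_sub_le hb
  refine ⟨C, fun m t y => ?_, fun m t R y z hy hz => ?_⟩
  · rw [interactionField, norm_smul, Complex.norm_I, one_mul, LinearIsometry.norm_map]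
    simpa using hC1 (freeFlow m t y)
  · rw [interactionField, interactionField, ← smul_sub, norm_smul, Complex.norm_I, one_mul,
      ← map_sub, LinearIsometry.norm_map]
    simpa [← map_sub] using hC2 R (freeFlow m t y) (freeFlow m t z) (by simpa) (by simpa)

lemma interactionField_smul (m b t θ : ℝ) (y : L2) :
    interactionField m b t ((θ : ℂ) • y) = ((θ ^ 3 : ℝ) : ℂ) • interactionField m b t y := by
  rw [interactionField, interactionField, map_smul, hartree_smul, map_smul, smul_comm]

lemma inner_interactionField_re (m b t : ℝ) (y : L2) :
    (⟪y, interactionField m b t y⟫_ℂ).re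
      = -(⟪freeFlow m t y, hartree b (freeFlow m t y)⟫_ℂ).im := by
  rw [interactionField, inner_smul_right, inner_freeFlow_neg_right]
  simp

lemma inner_lowerOp_interactionField_re (m t : ℝ) {b : ℝ} (hb : 0 < b) (y : L2) :
    (⟪lowerOp y, lowerOp (interactionField m b t y)⟫_ℂ).re = 0 := by
  rw [interactionField, map_smul, inner_smul_right, lowerOp_freeFlow, inner_freeFlow_neg_right,
    ← lowerOp_freeFlow]
  simp [inner_lowerOp_hartree_im hb]

lemma hasDerivWithinAt_norm_sq {y : ℝ → L2} {y' : L2} {s : Set ℝ} {t : ℝ}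
    (h : HasDerivWithinAt y y' s t) :
    HasDerivWithinAt (fun τ => ‖y τ‖ ^ 2) (2 * (⟪y t, y'⟫_ℂ).re) s t := by
  have h1 := h.inner ℂ h
  have h2 := (Complex.reCLM.hasFDerivAt (x := ⟪y t, y t⟫_ℂ)).comp_hasDerivWithinAt t h1
  refine (h2.congr_deriv ?_).congr (fun τ _ => ?_) ?_
  · rw [Complex.reCLM_apply, Complex.add_re, ← inner_conj_symm y' (y t), Complex.conj_re]
    ring
  · exact (inner_self_eq_norm_sq (𝕜 := ℂ) (y τ)).symm
  · exact (inner_self_eq_norm_sq (𝕜 := ℂ) (y t)).symm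

/-! ### Radial truncation -/

/-- The factor that retracts a vector of `L²` radially to the ball of radius `R`. -/
def truncFactor (R : ℝ) (y : L2) : ℝ := R / max R ‖y‖

lemma truncFactor_nonneg {R : ℝ} (hR : 0 < R) (y : L2) : 0 ≤ truncFactor R y :=
  div_nonneg hR.le (hR.le.trans (le_max_left _ _))

lemma truncFactor_le_one {R : ℝ} (hR : 0 < R) (y : L2) : truncFactor R y ≤ 1 :=
  div_le_one_of_le₀ (le_max_left _ _) (hR.le.trans (le_max_left _ _))

lemma truncFactor_eq_one {R : ℝ} (hR : 0 < R) {y : L2} (h : ‖y‖ ≤ R) : truncFactor R y = 1 := by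
  rw [truncFactor, max_eq_left h, div_self hR.ne']

lemma norm_truncFactor_smul_le {R : ℝ} (hR : 0 < R) (y : L2) :
    ‖(truncFactor R y : ℂ) • y‖ ≤ R := by
  have hpos : 0 < max R ‖y‖ := hR.trans_le (le_max_left _ _)
  rw [norm_smul, Complex.norm_real, Real.norm_eq_abs, abs_of_nonneg (truncFactor_nonneg hR y),
    truncFactor, div_mul_eq_mul_div, div_le_iff₀ hpos]
  gcongr
  exact le_max_right _ _

lemma norm_truncFactor_smul_sub_le {R : ℝ} (hR : 0 < R) (x y : L2) :
    ‖(truncFactor R x : ℂ) • x - (truncFactor R y : ℂ) • y‖ ≤ 2 * ‖x - y‖ := by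
  have hx : 0 < max R ‖x‖ := hR.trans_le (le_max_left _ _)
  have hy : 0 < max R ‖y‖ := hR.trans_le (le_max_left _ _)
  have h1 : (truncFactor R x : ℂ) • x - (truncFactor R y : ℂ) • y
      = (truncFactor R x : ℂ) • (x - y) + ((truncFactor R x - truncFactor R y : ℝ) : ℂ) • y := by
    push_cast
    rw [smul_sub, sub_smul]
    abel
  have h2 : ‖(truncFactor R x : ℂ) • (x - y)‖ ≤ 1 * ‖x - y‖ := by
    rw [norm_smul, Complex.norm_real, Real.norm_eq_abs, abs_of_nonneg (truncFactor_nonneg hR x)]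
    gcongr
    exact truncFactor_le_one hR x
  have h3 : truncFactor R x - truncFactor R y
      = truncFactor R x * ((max R ‖y‖ - max R ‖x‖) / max R ‖y‖) := by
    rw [truncFactor, truncFactor]
    field_simp
  have h4 : |max R ‖y‖ - max R ‖x‖| ≤ ‖x - y‖ := by
    refine (abs_max_sub_max_le_max _ _ _ _).trans ?_
    rw [sub_self, abs_zero, max_eq_right (abs_nonneg _), norm_sub_rev]
    exact abs_norm_sub_norm_le y x
  have h5 : ‖((truncFactor R x - truncFactor R y : ℝ) : ℂ) • y‖ ≤ ‖x - y‖ := by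
    rw [norm_smul, Complex.norm_real, Real.norm_eq_abs, h3, abs_mul, abs_div, abs_of_pos hy,
      abs_of_nonneg (truncFactor_nonneg hR x)]
    calc _ ≤ 1 * (‖x - y‖ / max R ‖y‖) * max R ‖y‖ := by
          gcongr
          · exact truncFactor_le_one hR x
          · exact le_max_right _ _
      _ = _ := by field_simp
  rw [h1]
  refine (norm_add_le _ _).trans ?_
  linarith

/-! ### Global solutions in the interaction picture -/

/-- The truncated equation has a bounded, globally Lipschitz vector field, so its solutions exist on
every time interval. -/
lemma exists_truncated_solution (m : ℝ) {b : ℝ} (hb : 0 < b) {R : ℝ} (hR : 0 < R) (y₀ : L2)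
    {T : ℝ} (hT : 0 ≤ T) :
    ∃ y : ℝ → L2, y 0 = y₀ ∧ ∀ t ∈ Set.Icc 0 T, HasDerivWithinAt y
      (interactionField m b t ((truncFactor R (y t) : ℂ) • y t)) (Set.Icc 0 T) t := by
  obtain ⟨C, hC1, hC2⟩ := exists_norm_interactionField_sub_le hb
  lift R to ℝ≥0 using hR.le
  lift T to ℝ≥0 using hT
  -- the field is bounded by `C R³` everywhere, so a ball of radius `C R³ T` is large enough
  have hPL : IsPicardLindelof
      (fun t y => interactionField m b t ((truncFactor R y : ℂ) • y))
      (⟨0, ⟨le_rfl, T.2⟩⟩ : Set.Icc (0 : ℝ) T) y₀ (C * R ^ 3 * T) 0 (C * R ^ 3)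
      (C * (3 * R ^ 2) * 2) := by
    refine ⟨fun t _ => ?_, fun y _ => ?_, fun t _ y _ => ?_, ?_⟩
    · refine LipschitzOnWith.of_dist_le_mul fun x _ y _ => ?_
      rw [dist_eq_norm, dist_eq_norm]
      refine (hC2 m t R _ _ (norm_truncFactor_smul_le hR x)
        (norm_truncFactor_smul_le hR y)).trans ?_
      push_cast
      rw [mul_assoc _ (2 : ℝ)]
      gcongr
      exact norm_truncFactor_smul_sub_le hR x y
    · exact ((continuous_interactionField m hb).comp
        (continuous_id.prodMk continuous_const)).continuousOn
    · refine (hC1 m t _).trans ?_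
      push_cast
      gcongr
      exact norm_truncFactor_smul_le hR y
    · simp
  exact hPL.exists_eq_forall_mem_Icc_hasDerivWithinAt₀

lemma norm_lowerOp_le (f : L2) : ‖lowerOp f‖ ≤ ‖f‖ := by
  refine (norm_mulOp_le _ f).trans (mul_le_of_le_one_left (norm_nonneg f) ?_)
  exact BoundedContinuousFunction.norm_ofNormedAddCommGroup_le _ zero_le_one _

lemma hasDerivWithinAt_Ici_of_Icc {E : Type*} [NormedAddCommGroup E] [NormedSpace ℝ E]
    {f : ℝ → E} {f' : E} {t T : ℝ} (h : HasDerivWithinAt f f' (Set.Icc 0 T) t)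
    (ht : t ∈ Set.Ico 0 T) : HasDerivWithinAt f f' (Set.Ici t) t :=
  h.mono_of_mem_nhdsWithin (Icc_mem_nhdsGE_of_mem ht)

/-- The a priori bound, for the equation with an arbitrary damping factor `θ ∈ [0, 1]` inside the
nonlinearity: the charge is conserved, and the energy inequality with the frequency threshold
`R = ‖y‖² + 1` gives exponential growth at most. -/
lemma exists_apriori_bound {b : ℝ} (hb : 0 < b) :
    ∃ C : ℝ, 0 < C ∧ ∀ (m T : ℝ) (θ : ℝ → ℝ) (y : ℝ → L2),
      (∀ t ∈ Set.Icc 0 T, 0 ≤ θ t ∧ θ t ≤ 1) →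
      (∀ t ∈ Set.Icc 0 T,
        HasDerivWithinAt y (interactionField m b t ((θ t : ℂ) • y t)) (Set.Icc 0 T) t) →
      ∀ t ∈ Set.Icc 0 T,
        ‖y t‖ ^ 2 + 1 ≤ (‖y 0‖ ^ 2 + 1) * Real.exp (C * (1 + ‖y 0‖ ^ 4) * t) := by
  obtain ⟨C, hC, hE⟩ := exists_abs_inner_hartree_im_le hb
  refine ⟨2 * C, by positivity, fun m T θ y hθ hy => ?_⟩
  have hcont : ContinuousOn y (Set.Icc 0 T) := fun t ht => (hy t ht).continuousWithinAt
  -- conservation of charge: the factor `θ³` is real, so it does not affect the cancellation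
  have hq : ∀ t ∈ Set.Icc 0 T, ‖lowerOp (y t)‖ ^ 2 = ‖lowerOp (y 0)‖ ^ 2 := by
    refine constant_of_has_deriv_right_zero ?_ fun t ht => ?_
    · exact (lowerOp.continuous.comp_continuousOn hcont).norm.pow 2
    · have h1 := (lowerOp.restrictScalars ℝ).hasFDerivAt.comp_hasDerivWithinAt t
        (hy t (Set.Ico_subset_Icc_self ht))
      have h2 := hasDerivWithinAt_norm_sq (hasDerivWithinAt_Ici_of_Icc h1 ht)
      refine h2.congr_deriv ?_
      simp only [Function.comp_apply, ContinuousLinearMap.coe_restrictScalars']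
      rw [interactionField_smul, map_smul, inner_smul_right, Complex.re_ofReal_mul,
        inner_lowerOp_interactionField_re m t hb]
      simp
  set E' : ℝ → ℝ := fun t => 2 * (⟪y t, interactionField m b t ((θ t : ℂ) • y t)⟫_ℂ).re with hE'
  have hder : ∀ t ∈ Set.Ico 0 T,
      HasDerivWithinAt (fun τ => ‖y τ‖ ^ 2 + 1) (E' t) (Set.Ici t) t := fun t ht =>
    (hasDerivWithinAt_norm_sq
      (hasDerivWithinAt_Ici_of_Icc (hy t (Set.Ico_subset_Icc_self ht)) ht)).add_const 1
  have hbound : ∀ t ∈ Set.Ico 0 T,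
      ‖E' t‖ ≤ 2 * C * (1 + ‖y 0‖ ^ 4) * ‖‖y t‖ ^ 2 + 1‖ + 0 := by
    intro t ht
    have ht' := Set.Ico_subset_Icc_self ht
    set X := ‖y t‖ ^ 2 with hX
    have hX0 : 0 ≤ X := by positivity
    have h1 := hE (freeFlow m t (y t)) (X + 1) (by positivity)
    rw [LinearIsometry.norm_map, lowerOp_freeFlow, LinearIsometry.norm_map,
      show ‖lowerOp (y t)‖ ^ 4 = (‖lowerOp (y t)‖ ^ 2) ^ 2 by ring, hq t ht',
      show ‖y t‖ ^ 4 = X ^ 2 by rw [hX]; ring] at h1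
    have h2 : (‖lowerOp (y 0)‖ ^ 2) ^ 2 ≤ ‖y 0‖ ^ 4 := by
      rw [← pow_mul]
      exact pow_le_pow_left₀ (norm_nonneg _) (norm_lowerOp_le _) 4
    -- the choice `R = X + 1` makes both terms of the energy inequality linear in `X + 1`
    have h3 : (X + 1)⁻¹ * X ^ 2 ≤ X + 1 := by
      rw [inv_mul_le_iff₀ (by positivity)]
      nlinarith
    have h4 : |(⟪freeFlow m t (y t), hartree b (freeFlow m t (y t))⟫_ℂ).im|
        ≤ C * ((X + 1) * ‖y 0‖ ^ 4 + (X + 1)) := h1.trans (by gcongr)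
    have h5 : 0 ≤ θ t ^ 3 ∧ θ t ^ 3 ≤ 1 :=
      ⟨pow_nonneg (hθ t ht').1 3, pow_le_one₀ (hθ t ht').1 (hθ t ht').2⟩
    simp only [hE']
    rw [interactionField_smul, inner_smul_right, Complex.re_ofReal_mul, inner_interactionField_re,
      Real.norm_eq_abs, abs_mul, abs_mul, abs_neg, abs_two, abs_of_nonneg h5.1, Real.norm_eq_abs,
      abs_of_nonneg (show 0 ≤ X + 1 by positivity)]
    calc _ ≤ 2 * (1 * (C * ((X + 1) * ‖y 0‖ ^ 4 + (X + 1)))) := by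
          gcongr
          exact h5.2
      _ = _ := by ring
  intro t ht
  have h := norm_le_gronwallBound_of_norm_deriv_right_le
    (f := fun τ => ‖y τ‖ ^ 2 + 1) ((hcont.norm.pow 2).add continuousOn_const) hder
    (le_refl _) hbound t ht
  rw [gronwallBound_ε0, sub_zero, Real.norm_eq_abs, Real.norm_eq_abs,
    abs_of_nonneg (by positivity), abs_of_nonneg (by positivity)] at h
  exact h

/-- Solutions of the equation in the interaction picture, on a compact time interval. -/
def IsSolutionOn (m b : ℝ) (y₀ : L2) (T : ℝ) (y : ℝ → L2) : Prop :=
  y 0 = y₀ ∧ ∀ t ∈ Set.Icc 0 T,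
    HasDerivWithinAt y (interactionField m b t (y t)) (Set.Icc 0 T) t

lemma IsSolutionOn.mono {m b : ℝ} {y₀ : L2} {S T : ℝ} {y : ℝ → L2}
    (h : IsSolutionOn m b y₀ T y) (hS : S ≤ T) : IsSolutionOn m b y₀ S y :=
  ⟨h.1, fun t ht => (h.2 t ⟨ht.1, ht.2.trans hS⟩).mono (Set.Icc_subset_Icc_right hS)⟩

lemma IsSolutionOn.continuousOn {m b : ℝ} {y₀ : L2} {T : ℝ} {y : ℝ → L2}
    (h : IsSolutionOn m b y₀ T y) : ContinuousOn y (Set.Icc 0 T) :=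
  fun t ht => (h.2 t ht).continuousWithinAt

lemma IsSolutionOn.eqOn {m b : ℝ} (hb : 0 < b) {y₀ : L2} {T : ℝ} {y z : ℝ → L2}
    (hy : IsSolutionOn m b y₀ T y) (hz : IsSolutionOn m b y₀ T z) :
    Set.EqOn y z (Set.Icc 0 T) := by
  obtain ⟨C, -, hC⟩ := exists_norm_interactionField_sub_le hb
  obtain ⟨A, hA⟩ := isCompact_Icc.exists_bound_of_continuousOn hy.continuousOn
  obtain ⟨B, hB⟩ := isCompact_Icc.exists_bound_of_continuousOn hz.continuousOn
  set R : ℝ≥0 := (max A B).toNNReal with hR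
  have hAR : A ≤ R := (le_max_left A B).trans (Real.le_coe_toNNReal _)
  have hBR : B ≤ R := (le_max_right A B).trans (Real.le_coe_toNNReal _)
  refine ODE_solution_unique_of_mem_Icc_right (v := interactionField m b)
    (s := fun _ => Metric.closedBall 0 R) (K := C * (3 * R ^ 2)) (fun t _ => ?_)
    hy.continuousOn
    (fun t ht => hasDerivWithinAt_Ici_of_Icc (hy.2 t (Set.Ico_subset_Icc_self ht)) ht)
    (fun t ht => ?_) hz.continuousOn
    (fun t ht => hasDerivWithinAt_Ici_of_Icc (hz.2 t (Set.Ico_subset_Icc_self ht)) ht)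
    (fun t ht => ?_) (hy.1.trans hz.1.symm)
  · refine LipschitzOnWith.of_dist_le_mul fun u hu v hv => ?_
    rw [dist_eq_norm, dist_eq_norm]
    exact hC m t R u v (by simpa using hu) (by simpa using hv)
  · simpa using (hA t (Set.Ico_subset_Icc_self ht)).trans hAR
  · simpa using (hB t (Set.Ico_subset_Icc_self ht)).trans hBR

/-- Global existence with exponential growth. On `[0, T]` the solution of the truncated equation
obeys an a priori bound that does not depend on the truncation; when the truncation radius exceeds
that bound, the truncation is not active. -/
lemma exists_isSolutionOn {b : ℝ} (hb : 0 < b) :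
    ∃ C : ℝ, 0 < C ∧ ∀ (m : ℝ) (y₀ : L2) (T : ℝ), 0 ≤ T → ∃ y : ℝ → L2, IsSolutionOn m b y₀ T y ∧
      ∀ t ∈ Set.Icc 0 T, ‖y t‖ ^ 2 + 1 ≤ (‖y₀‖ ^ 2 + 1) * Real.exp (C * (1 + ‖y₀‖ ^ 4) * t) := by
  obtain ⟨C, hC, hap⟩ := exists_apriori_bound hb
  refine ⟨C, hC, fun m y₀ T hT => ?_⟩
  set R := (‖y₀‖ ^ 2 + 1) * Real.exp (C * (1 + ‖y₀‖ ^ 4) * T) with hRdef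
  have hR1 : 1 ≤ R := by
    have h1 : 1 ≤ Real.exp (C * (1 + ‖y₀‖ ^ 4) * T) := Real.one_le_exp (by positivity)
    nlinarith [sq_nonneg ‖y₀‖]
  have hR : 0 < R := one_pos.trans_le hR1
  obtain ⟨y, hy0, hy⟩ := exists_truncated_solution m hb hR y₀ hT
  have hbd := hap m T (fun t => truncFactor R (y t)) y
    (fun t _ => ⟨truncFactor_nonneg hR _, truncFactor_le_one hR _⟩) hy
  rw [hy0] at hbd
  refine ⟨y, ⟨hy0, fun t ht => ?_⟩, hbd⟩
  have h1 : ‖y t‖ ^ 2 + 1 ≤ R := (hbd t ht).trans (by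
    rw [hRdef]
    gcongr
    exact ht.2)
  have h2 : ‖y t‖ ≤ R := by nlinarith [norm_nonneg (y t)]
  have h3 := hy t ht
  rwa [truncFactor_eq_one hR h2, Complex.ofReal_one, one_smul] at h3

/-! ### Translation between the two pictures -/

lemma fourier_toField (g : L2) : 𝓕 (toField g) = lowerOp g :=
  (Lp.fourierTransformₗᵢ Plane Spinor).apply_symm_apply (lowerOp g)

/-- `toField` as a continuous linear map. -/
def toFieldCLM : L2 →L[ℂ] L2 := invFourier.toContinuousLinearMap ∘L lowerOp

lemma toField_sub (g h : L2) : toField (g - h) = toField g - toField h := map_sub toFieldCLM g h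

lemma sobolevENorm_toField (g : L2) : sobolevENorm (1 / 2) (toField g) = ‖g‖ₑ := by
  rw [sobolevENorm, Lp.enorm_def, fourier_toField]
  apply eLpNorm_congr_ae
  filter_upwards [coeFn_lowerOp g] with ξ h
  change sobolevWeight ξ • lowerOp g ξ = g ξ
  rw [h, Complex.coe_smul, smul_smul, mul_inv_cancel₀ (sobolevWeight_pos ξ).ne', one_smul]

lemma toField_injective : Function.Injective toField := by
  intro g h hgh
  have h1 := sobolevENorm_toField (g - h)
  rw [toField_sub, hgh, sub_self, ← sub_self (toField 0), ← toField_sub, sobolevENorm_toField,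
    sub_self, enorm_zero] at h1
  exact sub_eq_zero.1 (enorm_eq_zero.1 h1.symm)

lemma memH_toField (g : L2) : MemH (1 / 2) (toField g) := by
  rw [MemH, sobolevENorm_toField]
  exact enorm_lt_top

lemma sobolevNorm_toField (g : L2) : sobolevNorm (1 / 2) (toField g) = ‖g‖ := by
  rw [sobolevNorm, sobolevENorm_toField, toReal_enorm]

lemma exists_toField_eq {u : L2} (hu : MemH (1 / 2) u) : ∃ g, toField g = u := by
  have hm : MemLp (fun ξ : Plane => sobolevWeight ξ • (𝓕 u : L2) ξ) 2 volume :=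
    ⟨continuous_sobolevWeight.aestronglyMeasurable.smul (Lp.aestronglyMeasurable _), hu⟩
  refine ⟨hm.toLp _, ?_⟩
  have h : lowerOp (hm.toLp _) = 𝓕 u := by
    apply Lp.ext
    filter_upwards [coeFn_lowerOp (hm.toLp _), hm.coeFn_toLp] with ξ h1 h2
    rw [h1, h2, Complex.coe_smul, smul_smul, inv_mul_cancel₀ (sobolevWeight_pos ξ).ne', one_smul]
  rw [toField, h]
  exact (Lp.fourierTransformₗᵢ Plane Spinor).symm_apply_apply u

lemma propagator_toField (m t : ℝ) (g : L2) :
    propagator m t (toField g) = toField (freeFlow m t g) := by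
  change invFourier (freeFlow m t (𝓕 (toField g))) = invFourier (lowerOp (freeFlow m t g))
  rw [fourier_toField, lowerOp_freeFlow]

lemma norm_alpha1_apply (v : Spinor) :
    ‖Matrix.toEuclideanCLM (n := Fin 2) (𝕜 := ℂ) alpha1 v‖ = ‖v‖ := by
  simp [EuclideanSpace.norm_eq, alpha1, Matrix.ofLp_toEuclideanCLM,
    Matrix.mulVec, dotProduct, Fin.sum_univ_two, add_comm]

lemma norm_alpha2_apply (v : Spinor) :
    ‖Matrix.toEuclideanCLM (n := Fin 2) (𝕜 := ℂ) alpha2 v‖ = ‖v‖ := by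
  simp [EuclideanSpace.norm_eq, alpha2, Matrix.ofLp_toEuclideanCLM,
    Matrix.mulVec, dotProduct, Fin.sum_univ_two, add_comm]

lemma norm_diracSymbol_apply_le (m : ℝ) (ξ : Plane) (v : Spinor) :
    ‖diracSymbol m ξ v‖ ≤ (2 + |m|) * sobolevWeight ξ ^ 2 * ‖v‖ := by
  have h0 := two_pi_mul_norm_le_sobolevWeight_sq ξ
  have h1 : ∀ i, |2 * Real.pi * ξ i| ≤ sobolevWeight ξ ^ 2 := fun i => by
    rw [abs_mul, abs_of_pos (by positivity)]
    refine le_trans ?_ h0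
    have := PiLp.norm_apply_le ξ i
    rw [Real.norm_eq_abs] at this
    have := Real.pi_pos
    gcongr
  have h2 : 1 ≤ sobolevWeight ξ ^ 2 := one_le_pow₀ (one_le_sobolevWeight ξ)
  have h3 : diracSymbol m ξ v
      = ((2 * Real.pi * ξ 0 : ℝ) : ℂ) • Matrix.toEuclideanCLM (n := Fin 2) (𝕜 := ℂ) alpha1 v
      + ((2 * Real.pi * ξ 1 : ℝ) : ℂ) • Matrix.toEuclideanCLM (n := Fin 2) (𝕜 := ℂ) alpha2 v
      + (m : ℂ) • Matrix.toEuclideanCLM (n := Fin 2) (𝕜 := ℂ) gamma0 v := by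
    simp only [diracSymbol, diracMatrix, map_add, map_smul]
    rfl
  rw [h3]
  refine norm_add₃_le.trans ?_
  rw [norm_smul, norm_smul, norm_smul, norm_alpha1_apply, norm_alpha2_apply, norm_gamma0_apply,
    Complex.norm_real, Complex.norm_real, Complex.norm_real, Real.norm_eq_abs, Real.norm_eq_abs,
    Real.norm_eq_abs]
  calc _ ≤ sobolevWeight ξ ^ 2 * ‖v‖ + sobolevWeight ξ ^ 2 * ‖v‖
        + |m| * sobolevWeight ξ ^ 2 * ‖v‖ := by
        gcongr
        · exact h1 0
        · exact h1 1
        · exact le_mul_of_one_le_right (abs_nonneg m) h2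
    _ = _ := by ring

/-- The quadratic form of the Dirac operator is bounded on `H^{1/2}`. -/
lemma norm_kineticEnergy_toField_le (m : ℝ) (g : L2) :
    ‖kineticEnergy m (toField g)‖ ≤ (2 + |m|) * ‖g‖ ^ 2 := by
  have h1 : ‖kineticEnergy m (toField g)‖ₑ ≤ ENNReal.ofReal (2 + |m|) * ‖g‖ₑ ^ 2 := by
    rw [← lintegral_enorm_sq, ← lintegral_const_mul _ ((measurable_enorm_coe g).pow_const 2),
      kineticEnergy, fourier_toField]
    refine (enorm_integral_le_lintegral_enorm _).trans (lintegral_mono_ae ?_)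
    filter_upwards [coeFn_lowerOp g] with ξ h
    rw [← ofReal_norm, ← ofReal_norm, ← ENNReal.ofReal_pow (norm_nonneg _),
      ← ENNReal.ofReal_mul (by positivity)]
    apply ENNReal.ofReal_le_ofReal
    have hs := sobolevWeight_pos ξ
    have h2 : ‖lowerOp g ξ‖ = (sobolevWeight ξ)⁻¹ * ‖g ξ‖ := by
      rw [h, norm_smul, Complex.norm_real, Real.norm_eq_abs, abs_of_pos (inv_pos.2 hs)]
    calc _ ≤ ‖diracSymbol m ξ (lowerOp g ξ)‖ * ‖lowerOp g ξ‖ := norm_inner_le_norm _ _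
      _ ≤ (2 + |m|) * sobolevWeight ξ ^ 2 * ‖lowerOp g ξ‖ * ‖lowerOp g ξ‖ := by
          gcongr
          exact norm_diracSymbol_apply_le m ξ _
      _ = _ := by
          rw [h2]
          field_simp
  rw [← ofReal_norm, ← ofReal_norm, ← ENNReal.ofReal_pow (norm_nonneg _),
    ← ENNReal.ofReal_mul (by positivity), ENNReal.ofReal_le_ofReal_iff (by positivity)] at h1
  exact h1

lemma continuousOn_freeFlow (m : ℝ) {τ : ℝ → ℝ} {y : ℝ → L2} {S : Set ℝ} (hτ : ContinuousOn τ S)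
    (hy : ContinuousOn y S) : ContinuousOn (fun t => freeFlow m (τ t) (y t)) S :=
  Continuous.comp_continuousOn (g := fun p : ℝ × L2 => freeFlow m p.1 p.2)
    (f := fun t => (τ t, y t)) (continuous_freeFlow m) (hτ.prodMk hy)

lemma continuousOn_interactionField (m : ℝ) {b : ℝ} (hb : 0 < b) {y : ℝ → L2} {S : Set ℝ}
    (hy : ContinuousOn y S) : ContinuousOn (fun t => interactionField m b t (y t)) S :=
  Continuous.comp_continuousOn (g := fun p : ℝ × L2 => interactionField m b p.1 p.2)
    (f := fun t => (t, y t)) (continuous_interactionField m hb) (continuousOn_id.prodMk hy)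

lemma toField_freeFlow_interactionField (m b s t : ℝ) (y : L2) :
    toField (freeFlow m t (interactionField m b s y))
      = Complex.I • toField (freeFlow m (t - s) (hartree b (freeFlow m s y))) := by
  rw [sub_eq_add_neg, freeFlow_add, interactionField, (freeFlow m t).map_smul]
  exact toFieldCLM.map_smul _ _

/-- Duhamel's formula, transported from the interaction picture. -/
lemma duhamel_toField (m : ℝ) {b : ℝ} (hb : 0 < b) (y₀ : L2) {y : ℝ → L2} {t : ℝ} (ht : 0 ≤ t)
    (hy : ContinuousOn y (Set.Icc 0 t)) :
    IntervalIntegrable (fun s => propagator m (t - s) (toField (hartree b (freeFlow m s (y s)))))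
      volume 0 t ∧
    propagator m t (toField y₀) + Complex.I •
        ∫ s in (0 : ℝ)..t, propagator m (t - s) (toField (hartree b (freeFlow m s (y s))))
      = toField (freeFlow m t (y₀ + ∫ s in (0 : ℝ)..t, interactionField m b s (y s))) := by
  set L : L2 →L[ℂ] L2 := toFieldCLM ∘L (freeFlow m t).toContinuousLinearMap with hL
  have hLa : ∀ g, L g = toField (freeFlow m t g) := fun g => rfl
  have hc : ContinuousOn (fun s => interactionField m b s (y s)) (Set.uIcc 0 t) := by
    rw [Set.uIcc_of_le ht]
    exact continuousOn_interactionField m hb hy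
  have hi := hc.intervalIntegrable (μ := volume)
  have hs : ∀ s, propagator m (t - s) (toField (hartree b (freeFlow m s (y s))))
      = (-Complex.I) • L (interactionField m b s (y s)) := fun s => by
    rw [hLa, propagator_toField, toField_freeFlow_interactionField, smul_smul, neg_mul,
      Complex.I_mul_I, neg_neg, one_smul]
  simp_rw [hs]
  have hLc : ContinuousOn (fun s => L (interactionField m b s (y s))) (Set.uIcc 0 t) :=
    L.continuous.comp_continuousOn hc
  have hLs : ContinuousOn (fun s => (-Complex.I) • L (interactionField m b s (y s)))
      (Set.uIcc 0 t) :=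
    (continuous_const_smul (-Complex.I)).comp_continuousOn hLc
  refine ⟨hLs.intervalIntegrable, ?_⟩
  rw [intervalIntegral.integral_smul, smul_smul, L.intervalIntegral_comp_comm hi,
    propagator_toField, ← hLa, ← hLa, map_add]
  simp

lemma IsSolutionOn.integral_eq {m b : ℝ} (hb : 0 < b) {y₀ : L2} {T : ℝ} {y : ℝ → L2}
    (h : IsSolutionOn m b y₀ T y) (hT : 0 ≤ T) :
    y₀ + ∫ s in (0 : ℝ)..T, interactionField m b s (y s) = y T := by
  have h1 := ODE.picard_eq_of_hasDerivAt (f := interactionField m b) (α := y) (t₀ := 0) (t := T)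
    (u := Set.univ) (continuous_interactionField m hb).continuousOn
    (by rw [Set.uIcc_of_le hT]; exact h.2) (Set.mapsTo_univ _ _)
  rwa [ODE.picard_apply, h.1] at h1

lemma isSolutionOn_of_integral_eq {m b : ℝ} (hb : 0 < b) {y₀ : L2} {T : ℝ} {y : ℝ → L2}
    (hT : 0 ≤ T) (hy : ContinuousOn y (Set.Icc 0 T))
    (h : ∀ t ∈ Set.Icc 0 T, y t = y₀ + ∫ s in (0 : ℝ)..t, interactionField m b s (y s)) :
    IsSolutionOn m b y₀ T y := by
  have h0 : (0 : ℝ) ∈ Set.Icc 0 T := ⟨le_rfl, hT⟩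
  refine ⟨by simpa using h 0 h0, fun t ht => ?_⟩
  have h1 := ODE.hasDerivWithinAt_picard_Icc (f := interactionField m b) (u := Set.univ) h0
    (continuous_interactionField m hb).continuousOn hy (fun _ _ => Set.mem_univ _) y₀ ht
  exact h1.congr h (h t ht)

/-- The interaction-picture representative of a global solution of the integral equation. -/
lemma IsGlobalSolution.exists_interaction {m b : ℝ} (hb : 0 < b) {y₀ : L2} {φ : ℝ → L2}
    (hφ : IsGlobalSolution m b (toField y₀) φ) :
    ∃ z : ℝ → L2, (∀ T, 0 ≤ T → IsSolutionOn m b y₀ T z) ∧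
      ∀ t, 0 ≤ t → φ t = toField (freeFlow m t (z t)) := by
  obtain ⟨⟨hmem, hcont⟩, F, hF, hint⟩ := hφ
  have hex : ∀ t, ∃ g, 0 ≤ t → toField g = φ t := fun t => by
    by_cases ht : 0 ≤ t
    · obtain ⟨g, hg⟩ := exists_toField_eq (hmem t ht)
      exact ⟨g, fun _ => hg⟩
    · exact ⟨0, fun h => absurd h ht⟩
  choose g hg using hex
  have hgc : ContinuousOn g (Set.Ici 0) := fun t ht => by
    rw [ContinuousWithinAt, tendsto_iff_edist_tendsto_0]
    refine (hcont t ht).congr' ?_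
    filter_upwards [self_mem_nhdsWithin] with τ hτ
    rw [← hg τ hτ, ← hg t ht, ← toField_sub, sobolevENorm_toField, edist_eq_enorm_sub]
  set z : ℝ → L2 := fun t => freeFlow m (-t) (g t) with hz
  have hzc : ContinuousOn z (Set.Ici 0) :=
    continuousOn_freeFlow m continuous_neg.continuousOn hgc
  have hgz : ∀ t, freeFlow m t (z t) = g t := fun t => freeFlow_freeFlow_neg m t (g t)
  have hFz : ∀ s, 0 ≤ s → F s = toField (hartree b (freeFlow m s (z s))) := fun s hs => by
    apply Lp.ext
    rw [hgz]
    have h1 := coeFn_toField_hartree hb (g s)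
    rw [hg s hs] at h1
    exact (hF s hs).trans h1.symm
  refine ⟨z, fun T hT => isSolutionOn_of_integral_eq hb hT (hzc.mono fun t ht => ht.1) ?_,
    fun t ht => by rw [hgz, hg t ht]⟩
  intro t ht
  have h1 := (hint t ht.1).2
  have h2 : ∫ s in (0 : ℝ)..t, propagator m (t - s) (F s)
      = ∫ s in (0 : ℝ)..t, propagator m (t - s) (toField (hartree b (freeFlow m s (z s)))) := by
    apply intervalIntegral.integral_congr
    intro s hs
    rw [Set.uIcc_of_le ht.1] at hs
    simp only [hFz s hs.1]
  rw [h2, (duhamel_toField m hb y₀ ht.1 (hzc.mono fun t ht => ht.1)).2, ← hg t ht.1, ← hgz] at h1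
  exact (freeFlow m t).injective (toField_injective h1)

lemma isGlobalSolution_toField {m b : ℝ} (hb : 0 < b) {y₀ : L2} {y : ℝ → L2}
    (hy : ∀ T, 0 ≤ T → IsSolutionOn m b y₀ T y) :
    IsGlobalSolution m b (toField y₀) fun t => toField (freeFlow m t (y t)) := by
  have hyc : ContinuousOn y (Set.Ici 0) := fun t ht => by
    have ht : 0 ≤ t := ht
    have h1 := (hy (t + 1) (by positivity)).continuousOn t ⟨ht, by linarith⟩
    refine h1.mono_of_mem_nhdsWithin ?_
    filter_upwards [self_mem_nhdsWithin, mem_nhdsWithin_of_mem_nhds (Iic_mem_nhds (lt_add_one t))]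
      with τ h2 h3 using ⟨h2, h3⟩
  refine ⟨⟨fun t _ => memH_toField _, fun t ht => ?_⟩,
    fun s => toField (hartree b (freeFlow m s (y s))),
    fun s _ => coeFn_toField_hartree hb _, fun t ht => ?_⟩
  · have h1 : ContinuousOn (fun t => freeFlow m t (y t)) (Set.Ici 0) :=
      continuousOn_freeFlow m continuousOn_id hyc
    have h2 := tendsto_iff_edist_tendsto_0.1 (h1 t ht)
    refine h2.congr fun τ => ?_
    rw [← toField_sub, sobolevENorm_toField, edist_eq_enorm_sub]
  · obtain ⟨h1, h2⟩ := duhamel_toField m hb y₀ ht (hyc.mono fun t ht => ht.1)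
    refine ⟨h1, ?_⟩
    rw [h2, (hy t ht).integral_eq hb ht]

/-- Solutions on the intervals `[0, T]` agree where they overlap, and fit together to one on
`[0, ∞)`. -/
lemma exists_global_isSolutionOn {b : ℝ} (hb : 0 < b) :
    ∃ C : ℝ, 0 < C ∧ ∀ (m : ℝ) (y₀ : L2), ∃ y : ℝ → L2, (∀ T, 0 ≤ T → IsSolutionOn m b y₀ T y) ∧
      ∀ t, 0 ≤ t → ‖y t‖ ^ 2 + 1 ≤ (‖y₀‖ ^ 2 + 1) * Real.exp (C * (1 + ‖y₀‖ ^ 4) * t) := by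
  obtain ⟨C, hC, hex⟩ := exists_isSolutionOn hb
  refine ⟨C, hC, fun m y₀ => ?_⟩
  have hex' : ∀ T, ∃ y : ℝ → L2, 0 ≤ T → IsSolutionOn m b y₀ T y ∧ ∀ t ∈ Set.Icc 0 T,
      ‖y t‖ ^ 2 + 1 ≤ (‖y₀‖ ^ 2 + 1) * Real.exp (C * (1 + ‖y₀‖ ^ 4) * t) := fun T => by
    by_cases hT : 0 ≤ T
    · obtain ⟨y, hy⟩ := hex m y₀ T hT
      exact ⟨y, fun _ => hy⟩
    · exact ⟨0, fun h => absurd h hT⟩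
  choose α hα using hex'
  have heq : ∀ T, 0 ≤ T → Set.EqOn (fun t => α t t) (α T) (Set.Icc 0 T) := fun T hT t ht =>
    (hα t ht.1).1.eqOn hb ((hα T hT).1.mono ht.2) ⟨ht.1, le_rfl⟩
  refine ⟨fun t => α t t, fun T hT => ⟨?_, fun t ht => ?_⟩, fun t ht => (hα t ht).2 t ⟨ht, le_rfl⟩⟩
  · exact (hα 0 le_rfl).1.1
  · have h1 := (hα T hT).1.2 t ht
    have h2 : α t t = α T t := heq T hT ht
    simp only [h2]
    exact h1.congr (heq T hT) (heq T hT ht)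

end DiracHartree

end

theorem theorem4 (m b : ℝ) (hm : 0 < m) (hb : 0 < b) :
    ∃ C K : ℝ → ℝ, (∀ r, 0 < C r) ∧ (∀ r, 0 < K r) ∧
      ∀ ψ₀ : DiracHartree.L2, DiracHartree.MemH (1 / 2) ψ₀ →
        ∃ ψ : ℝ → DiracHartree.L2,
          DiracHartree.IsGlobalSolution m b ψ₀ ψ ∧
          (∀ φ : ℝ → DiracHartree.L2, DiracHartree.IsGlobalSolution m b ψ₀ φ →
            ∀ t, 0 ≤ t → φ t = ψ t) ∧
          ∀ t, 0 ≤ t →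
            ‖DiracHartree.kineticEnergy m (ψ t)‖ ≤
              K (DiracHartree.sobolevNorm (1 / 2) ψ₀) *
                Real.exp (C (DiracHartree.sobolevNorm (1 / 2) ψ₀) * t) := by
  obtain ⟨C, hC, hex⟩ := DiracHartree.exists_global_isSolutionOn hb
  refine ⟨fun r => C * (1 + r ^ 4), fun r => (2 + |m|) * (r ^ 2 + 1), fun r => by positivity,
    fun r => by positivity, fun ψ₀ hψ₀ => ?_⟩
  obtain ⟨y₀, rfl⟩ := DiracHartree.exists_toField_eq hψ₀
  obtain ⟨y, hy, hbound⟩ := hex m y₀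
  refine ⟨fun t => DiracHartree.toField (DiracHartree.freeFlow m t (y t)),
    DiracHartree.isGlobalSolution_toField hb hy,
    fun φ hφ t ht => ?_, fun t ht => ?_⟩
  · obtain ⟨z, hz, hφz⟩ := hφ.exists_interaction hb
    simp only
    rw [hφz t ht, (hz t ht).eqOn hb (hy t ht) ⟨ht, le_rfl⟩]
  · refine (DiracHartree.norm_kineticEnergy_toField_le m _).trans ?_
    simp only
    rw [DiracHartree.sobolevNorm_toField, LinearIsometry.norm_map, mul_assoc]
    gcongr
    linarith [hbound t ht]
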